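/- **Setting.** Let $X_t=f_t+\epsilon_t$, $t=1,\dots,T$, with $\epsilon_1,\dots,\epsilon_T$ i.i.d. $\mathcal N(0,1)$ and $f$ piecewise constant with exactly $N\ge 0$ change-points $r_1<\dots<r_N$: with $r_0=0$, $r_{N+1}=T$, $f$ is constant on $\{r_{j}+1,\dots,r_{j+1}\}$ for $0\le j\le N$, and $f_{r_j}\ne f_{r_j+1}$ for $1\le j\le N$. Write $\Delta_j^f=|f_{r_j+1}-f_{r_j}|$, $\underline f_T=\min_{1\le j\le N}\Delta^f_j$, $\tilde\delta_j=r_{j+1}-r_j$ and $\delta_T=\min_{0\le j\le N}\tilde\delta_j$. Let $$C_{s,e}^b(X)=\Bigl|\sqrt{\tfrac{e-b}{\ell(b-s+1)}}\sum_{t=s}^bX_t-\sqrt{\tfrac{b-s+1}{\ell(e-b)}}\sum_{t=b+1}^eX_t\Bigr|,\qquad \ell=e-s+1,\ s\le b<e .$$ **Algorithm.** DAIS, with expansion parameter $\lambda_T\in\mathbb N$, $\lambda_T\ge1$, and threshold $\zeta_T$, applied to $[s,e]$, stops if $e-s<3$. Otherwise let $d=d_{s,e}=\operatorname{argmax}_{s\le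 t\le e-1}|X_{t+1}-X_t|$, $c^l_m=\max\{d-m\lambda_T,s\}$, $c^r_k=\min\{d+k\lambda_T-1,e\}$, $K^l=\lceil (d-s+1)/\lambda_T\rceil$, $K^r=\lceil (e-d+1)/\lambda_T\rceil$, $K^{\min}=\min\{K^l,K^r\}$, $K^{\max}=\max\{K^l,K^r\}$. It examines in order the intervals $[c^l_0,c^r_1],[c^l_1,c^r_1],[c^l_1,c^r_2],[c^l_2,c^r_2],\dots,[c^l_{K^{\min}},c^r_{K^{\min}}]$ and then $[c^l_i,c^r_i]$ for $i=K^{\min}+1,\dots,K^{\max}$. At the first of these, $[s',e']$, for which $b=\operatorname{argmax}_{s'\le t<e'}C^t_{s',e'}(X)$ satisfies $C^b_{s',e'}(X)>\zeta_T$, it records $b$ as an estimated change-point and is applied again to $[s,s']$ and to $[e',e]$; if there is none, it stops. Let $\hat r_1<\dots<\hat r_{\hat N}$ be the estimates produced by applying DAIS to $[1,T]$. **Assumptions.** Fix a constant $n\ge 3/2$, and let $\lambda_T\le\delta_T/(2n)$. (A1) Every time the algorithm is applied to an interval $[s,e]$ with $e-s\ge 3$ that contains a change-point (some $r_j$ with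 $s\le r_j<e$), $d_{s,e}$ lies in $$\Bigl[1,\,r_1+\tfrac{\tilde\delta_1}2-\tfrac{3\delta_T}{4n}\Bigr]\cup\Bigl[r_N-\tfrac{\tilde\delta_{N-1}}2+\tfrac{3\delta_T}{4n},\,T-1\Bigr]\cup\bigcup_{j=2}^{N-1}\Bigl[r_j-\tfrac{\tilde\delta_{j-1}}2+\tfrac{3\delta_T}{4n},\,r_j+\tfrac{\tilde\delta_j}2-\tfrac{3\delta_T}{4n}\Bigr].$$ (A2) $\sqrt{\delta_T}\,\underline f_T\ge \underline C\sqrt{\log T}$. **Theorem.** For every $n\ge 3/2$ there are positive constants $\underline C,C_1,C_2,C_3,C_4$ with $C_1<C_2\underline C$, and $T_0$, all depending on $n$ only, such that for all $T\ge T_0$, all $N,f,\lambda_T$ as above satisfying (A2), and all $\zeta_T$ with $C_1\sqrt{\log T}\le\zeta_T<C_2\sqrt{\delta_T}\,\underline f_T$, the following holds: with probability at least $1-C_4/T$, if (A1) holds for the observed data then $$\hat N=N\quad\text{and}\quad\max_{j=1,\dots,N}|\hat r_j-r_j|\,(\Delta_j^f)^2\le C_3\log T .$$ In particular, if (A1)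 holds almost surely, then $$\mathbb P\Bigl(\hat N=N,\ \max_{j=1,\dots,N}|\hat r_j-r_j|(\Delta_j^f)^2\le C_3\log T\Bigr)\ge 1-\frac{C_4}{T}.$$ (If $N=0$, then (A2), the upper bound on $\zeta_T$ and the bound on the maximum are void.) -/

import Mathlib

open MeasureTheory ProbabilityTheory

namespace DAIS

noncomputable section

/-! ### The signal -/

/-- `f_1, …, f_T` is piecewise constant with exactly `N` change-points `r 1 < ⋯ < r N`, with the
conventions `r 0 = 0` and `r (N+1) = T`: it is constant for `r j < t ≤ r (j+1)`, and
`f (r j) ≠ f (r j + 1)` at every change-point. Values of `r` beyond `N + 1`, and of `f` outside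
`{1, …, T}`, play no role. -/
structure IsPiecewiseConstant (T N : ℕ) (r : ℕ → ℕ) (f : ℕ → ℝ) : Prop where
  zero : r 0 = 0
  last : r (N + 1) = T
  lt : ∀ j ≤ N, r j < r (j + 1)
  const : ∀ j ≤ N, ∀ t, r j < t → t ≤ r (j + 1) → f t = f (r (j + 1))
  jump_ne : ∀ j, 1 ≤ j → j ≤ N → f (r j) ≠ f (r j + 1)

/-- The magnitude of the `j`-th change, `|f_{r_j + 1} - f_{r_j}|`. -/
def jump (r : ℕ → ℕ) (f : ℕ → ℝ) (j : ℕ) : ℝ := |f (r j + 1) - f (r j)|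

/-- The minimum magnitude of change, `min_{1 ≤ j ≤ N} |f_{r_j + 1} - f_{r_j}|`
(meaningful for `1 ≤ N`). -/
def minJump (N : ℕ) (r : ℕ → ℕ) (f : ℕ → ℝ) : ℝ := ⨅ j : Finset.Icc 1 N, jump r f j

/-- The distance `r_{j+1} - r_j`. -/
def gap (r : ℕ → ℕ) (j : ℕ) : ℝ := (r (j + 1) : ℝ) - (r j : ℝ)

/-- The minimum distance `min_{0 ≤ j ≤ N} (r_{j+1} - r_j)`. -/
def minGap (N : ℕ) (r : ℕ → ℕ) : ℝ := ⨅ j : Fin (N + 1), gap r j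

/-! ### The algorithm -/

/-- The (smallest) maximiser of `g` over `{a, a+1, …, b-1}`; meaningful for `a < b`. -/
def argmax (g : ℕ → ℝ) (a b : ℕ) : ℕ :=
  sInf {t | t ∈ Finset.Ico a b ∧ ∀ u ∈ Finset.Ico a b, g u ≤ g t}

theorem argmax_mem (g : ℕ → ℝ) {a b : ℕ} (h : a < b) : argmax g a b ∈ Finset.Ico a b := by
  obtain ⟨t, ht, hmax⟩ :=
    Finset.exists_max_image (Finset.Ico a b) g ⟨a, Finset.mem_Ico.2 ⟨le_rfl, h⟩⟩
  exact (Nat.sInf_mem (s := {t | t ∈ Finset.Ico a b ∧ ∀ u ∈ Finset.Ico a b, g u ≤ g t})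
    ⟨t, ht, hmax⟩).1

/-- The location `d_{s,e}` of the largest absolute difference of consecutive observations. -/
def largestDiff (X : ℕ → ℝ) (s e : ℕ) : ℕ := argmax (fun t => |X (t + 1) - X t|) s e

/-- The absolute value of the CUSUM statistic of `X_s, …, X_e` at `b`, for `s ≤ b < e`. -/
def cusum (X : ℕ → ℝ) (s e b : ℕ) : ℝ :=
  |√(((e : ℝ) - b) / (((e : ℝ) - s + 1) * ((b : ℝ) - s + 1))) * ∑ t ∈ Finset.Icc s b, X t
    - √(((b : ℝ) - s + 1) / (((e : ℝ) - s + 1) * ((e : ℝ) - b)))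
      * ∑ t ∈ Finset.Icc (b + 1) e, X t|

/-- `K^l = ⌈(d - s + 1) / λ⌉`. -/
def numLeft (lam s d : ℕ) : ℕ := ⌈((d : ℝ) - s + 1) / lam⌉₊

/-- `K^r = ⌈(e - d + 1) / λ⌉`. -/
def numRight (lam e d : ℕ) : ℕ := ⌈((e : ℝ) - d + 1) / lam⌉₊

/-- The left end-points `max {d - m λ, s}` (truncated subtraction is harmless). -/
def leftPt (lam s d m : ℕ) : ℕ := max (d - m * lam) s

/-- The right end-points `min {d + k λ - 1, e}`. -/
def rightPt (lam e d k : ℕ) : ℕ := min (d + k * lam - 1) e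

/-- The number `K = K^l + K^r` of intervals tested inside `[s, e]` around `d`. -/
def numIntervals (lam s e d : ℕ) : ℕ := numLeft lam s d + numRight lam e d

/-- The start-point of the `j`-th tested interval, `1 ≤ j ≤ K`: the `j`-th entry of
`c_0, c_1, c_1, c_2, …, c_{K^min - 1}, c_{K^min}, c_{K^min + 1}, …, c_{K^max}` (left points). -/
def startPt (lam s e d j : ℕ) : ℕ :=
  if j ≤ 2 * min (numLeft lam s d) (numRight lam e d) then leftPt lam s d (j / 2)
  else leftPt lam s d (j - min (numLeft lam s d) (numRight lam e d))

/-- The end-point of the `j`-th tested interval, `1 ≤ j ≤ K`: the `j`-th entry of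
`c_1, c_1, c_2, c_2, …, c_{K^min}, c_{K^min}, c_{K^min + 1}, …, c_{K^max}` (right points). -/
def endPt (lam s e d j : ℕ) : ℕ :=
  if j ≤ 2 * min (numLeft lam s d) (numRight lam e d) then rightPt lam e d ((j + 1) / 2)
  else rightPt lam e d (j - min (numLeft lam s d) (numRight lam e d))

/-- The start-point `s_j` of the `j`-th interval tested when the algorithm is applied to
`[s, e]`. -/
def testStart (X : ℕ → ℝ) (lam s e j : ℕ) : ℕ := startPt lam s e (largestDiff X s e) j

/-- The end-point `e_j` of the `j`-th interval tested when the algorithm is applied to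
`[s, e]`. -/
def testEnd (X : ℕ → ℝ) (lam s e j : ℕ) : ℕ := endPt lam s e (largestDiff X s e) j

/-- The location `b_j` at which the CUSUM contrast is maximal over the `j`-th tested interval. -/
def testLoc (X : ℕ → ℝ) (lam s e j : ℕ) : ℕ :=
  argmax (cusum X (testStart X lam s e j) (testEnd X lam s e j))
    (testStart X lam s e j) (testEnd X lam s e j)

/-- A change-point is declared in the `j`-th tested interval: the maximal contrast exceeds the
threshold. (An interval consisting of one point has no candidate location.) -/
def Detects (X : ℕ → ℝ) (lam : ℕ) (ζ : ℝ) (s e j : ℕ) : Prop :=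
  testStart X lam s e j < testEnd X lam s e j ∧
    ζ < cusum X (testStart X lam s e j) (testEnd X lam s e j) (testLoc X lam s e j)

open Classical in
/-- The index of the first tested interval of `[s, e]` in which a change-point is declared;
`none` if there is no such interval, or if `e - s < 3`, in which case nothing is tested. -/
def firstDetection (X : ℕ → ℝ) (lam : ℕ) (ζ : ℝ) (s e : ℕ) : Option ℕ :=
  if e < s + 3 then none
  else if h : ∃ j, 1 ≤ j ∧ j ≤ numIntervals lam s e (largestDiff X s e) ∧ Detects X lam ζ s e j
    then some (Nat.find h)
  else none

theorem firstDetection_bounds {X : ℕ → ℝ} {lam : ℕ} {ζ : ℝ} {s e j : ℕ}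
    (h : firstDetection X lam ζ s e = some j) :
    s ≤ testStart X lam s e j ∧ testStart X lam s e j < e ∧
      testStart X lam s e j < testEnd X lam s e j ∧ testEnd X lam s e j ≤ e := by
  classical
  unfold firstDetection at h
  split_ifs at h with h1 h2
  obtain rfl := Option.some.inj h
  have hd := (Nat.find_spec h2).2.2.1
  have hL := Finset.mem_Ico.1 (argmax_mem (fun t => |X (t + 1) - X t|) (show s < e by omega))
  have hs : s ≤ testStart X lam s e (Nat.find h2) := by
    unfold testStart startPt leftPt
    split_ifs <;> exact le_max_right _ _
  have he : testEnd X lam s e (Nat.find h2) ≤ e := by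
    unfold testEnd endPt rightPt
    split_ifs <;> exact min_le_right _ _
  exact ⟨hs, lt_of_lt_of_le hd he, hd, he⟩

/-- The algorithm applied to `[s, e]`, with expansion parameter `lam` and threshold `ζ`: the list
of estimated change-points. On a detection at `b` in `[s', e']` it restarts on `[s, s']` and on
`[e', e]`. Since `s ≤ s' ≤ b < e' ≤ e`, the list below is in increasing order
(`dais_pairwise_lt`). -/
def dais (X : ℕ → ℝ) (lam : ℕ) (ζ : ℝ) (s e : ℕ) : List ℕ :=
  match _h : firstDetection X lam ζ s e with
  | none => []
  | some j =>
      dais X lam ζ s (testStart X lam s e j) ++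
        testLoc X lam s e j :: dais X lam ζ (testEnd X lam s e j) e
termination_by e - s
decreasing_by
  · have := firstDetection_bounds ‹_›; omega
  · have := firstDetection_bounds ‹_›; omega

theorem dais_mem (X : ℕ → ℝ) (lam : ℕ) (ζ : ℝ) (s e : ℕ) :
    ∀ b ∈ dais X lam ζ s e, s ≤ b ∧ b < e := by
  fun_induction dais X lam ζ s e with
  | case1 => simp
  | case2 s e j h ih1 ih2 =>
    have hb := firstDetection_bounds h
    have hm := Finset.mem_Ico.1
      (argmax_mem (cusum X (testStart X lam s e j) (testEnd X lam s e j)) hb.2.2.1)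
    change testStart X lam s e j ≤ testLoc X lam s e j ∧
      testLoc X lam s e j < testEnd X lam s e j at hm
    intro b hmem
    rcases List.mem_append.1 hmem with h1 | h1
    · have := ih1 b h1; omega
    · rcases List.mem_cons.1 h1 with rfl | h1
      · omega
      · have := ih2 b h1; omega

/-- The estimates are listed in increasing order, without repetition. -/
theorem dais_pairwise_lt (X : ℕ → ℝ) (lam : ℕ) (ζ : ℝ) (s e : ℕ) :
    (dais X lam ζ s e).Pairwise (· < ·) := by
  fun_induction dais X lam ζ s e with
  | case1 => simp
  | case2 s e j h ih1 ih2 =>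
    have hb := firstDetection_bounds h
    have hm := Finset.mem_Ico.1
      (argmax_mem (cusum X (testStart X lam s e j) (testEnd X lam s e j)) hb.2.2.1)
    change testStart X lam s e j ≤ testLoc X lam s e j ∧
      testLoc X lam s e j < testEnd X lam s e j at hm
    have m1 := dais_mem X lam ζ s (testStart X lam s e j)
    have m2 := dais_mem X lam ζ (testEnd X lam s e j) e
    refine List.pairwise_append.2 ⟨ih1, List.pairwise_cons.2 ⟨fun b hb' => ?_, ih2⟩, ?_⟩
    · have := m2 b hb'; omega
    · intro a ha b hb'
      have := m1 a ha
      rcases List.mem_cons.1 hb' with rfl | hb'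
      · omega
      · have := m2 b hb'; omega

/-- The algorithm, started on `[1, T]`, is at some stage applied to `[s, e]`. -/
inductive IsCall (X : ℕ → ℝ) (lam : ℕ) (ζ : ℝ) (T : ℕ) : ℕ → ℕ → Prop
  | start : IsCall X lam ζ T 1 T
  | left {s e j : ℕ} : IsCall X lam ζ T s e → firstDetection X lam ζ s e = some j →
      IsCall X lam ζ T s (testStart X lam s e j)
  | right {s e j : ℕ} : IsCall X lam ζ T s e → firstDetection X lam ζ s e = some j →
      IsCall X lam ζ T (testEnd X lam s e j) e

/-! ### The assumption on the largest difference, and the conclusion -/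

/-- The admissible region for the location of the largest difference:
`[1, r_1 + δ_1/2 - 3δ/(4n)] ∪ [r_N - δ_{N-1}/2 + 3δ/(4n), T - 1]
  ∪ ⋃_{j=2}^{N-1} [r_j - δ_{j-1}/2 + 3δ/(4n), r_j + δ_j/2 - 3δ/(4n)]`,
with `δ_j = r_{j+1} - r_j` and `δ = min_j δ_j`. -/
def Admissible (n : ℝ) (T N : ℕ) (r : ℕ → ℕ) (d : ℕ) : Prop :=
  (1 ≤ d ∧ (d : ℝ) ≤ r 1 + gap r 1 / 2 - 3 * minGap N r / (4 * n)) ∨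
  ((r N : ℝ) - gap r (N - 1) / 2 + 3 * minGap N r / (4 * n) ≤ d ∧ d ≤ T - 1) ∨
  ∃ j, 2 ≤ j ∧ j ≤ N - 1 ∧
    (r j : ℝ) - gap r (j - 1) / 2 + 3 * minGap N r / (4 * n) ≤ d ∧
    (d : ℝ) ≤ r j + gap r j / 2 - 3 * minGap N r / (4 * n)

/-- Every time the algorithm is applied to an interval `[s, e]` that contains a change-point (and
in which it computes `d_{s,e}`, that is `e - s ≥ 3`), the location `d_{s,e}` of the largest
difference is in the admissible region. A change-point `ρ` is in `[s, e]` if the data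
`X_s, …, X_e` include both `X_ρ` and `X_{ρ+1}`. -/
def LargestDiffAdmissible (n : ℝ) (T N : ℕ) (r : ℕ → ℕ) (X : ℕ → ℝ) (lam : ℕ) (ζ : ℝ) : Prop :=
  ∀ s e, IsCall X lam ζ T s e → s + 3 ≤ e → (∃ j, 1 ≤ j ∧ j ≤ N ∧ s ≤ r j ∧ r j < e) →
    Admissible n T N r (largestDiff X s e)

/-- The estimated number of change-points. -/
def numEst (X : ℕ → ℝ) (lam : ℕ) (ζ : ℝ) (T : ℕ) : ℕ := (dais X lam ζ 1 T).length

/-- The `j`-th estimated change-point in increasing order, `1 ≤ j ≤ numEst`. -/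
def est (X : ℕ → ℝ) (lam : ℕ) (ζ : ℝ) (T j : ℕ) : ℕ := (dais X lam ζ 1 T).getD (j - 1) 0

/-- The number of change-points is estimated correctly, and
`max_{1 ≤ j ≤ N} |r̂_j - r_j| |f_{r_j + 1} - f_{r_j}|² ≤ B`. -/
def Accurate (T N : ℕ) (r : ℕ → ℕ) (f X : ℕ → ℝ) (lam : ℕ) (ζ B : ℝ) : Prop :=
  numEst X lam ζ T = N ∧
    ∀ j, 1 ≤ j → j ≤ N → |(est X lam ζ T j : ℝ) - r j| * jump r f j ^ 2 ≤ B

end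

end DAIS

namespace DAIS

/-! ### The weights of the CUSUM statistic -/

/-! The argument is deterministic on the event `NoiseBound`, where every block sum of the noise is
at most x times the root of its length. With x² = 6 log T the Gaussian tail is T⁻³ per block, and a
union bound over at most T² blocks gives a failure probability of at most 2/T.

A CUSUM value is the absolute inner product of the data with a vector of unit norm and zero sum, so
on this event its noise part is below 2x. Three facts about contrasts follow: an interval without a
change-point is never declared (`cusum_le_of_const`); an interval in which a sufficiently large jump
has enough data on both sides is always declared (`lt_cusum_of_jump`); and a declared maximiser in
an interval with one jump D is within 24x²/D² of it (`abs_sub_mul_sq_le`).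

The geometry is measured in units of y = δ/(2n). The assumption on d makes one change-point of the
current interval closer to d than its neighbours there, by 3y. Hence some symmetric expansion around
d gives this change-point y/2 observations on each side while still excluding the others. Detection
happens there or earlier, in a smaller interval, which must contain a change-point and so contains
exactly that one (`Regime.exists_detection`). The remaining change-points stay away from the ends of
the two new intervals, so the situation reproduces itself and induction on the length
(`Regime.forall₂_dais`) matches the estimates with the change-points in order. -/

/-- `u`, `v` are the weights of the CUSUM contrast between blocks of lengths `p` and `q`. -/
structure IsWeight (p q u v : ℝ) : Prop where
  pos_left : 0 < p
  pos_right : 0 < q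
  nonneg_left : 0 ≤ u
  nonneg_right : 0 ≤ v
  balance : u * p = v * q
  norm : u ^ 2 * p + v ^ 2 * q = 1

theorem isWeight_sqrt {p q : ℝ} (hp : 0 < p) (hq : 0 < q) :
    IsWeight p q (√(q / ((p + q) * p))) (√(p / ((p + q) * q))) := by
  have hu : √(q / ((p + q) * p)) ^ 2 = q / ((p + q) * p) := Real.sq_sqrt (by positivity)
  have hv : √(p / ((p + q) * q)) ^ 2 = p / ((p + q) * q) := Real.sq_sqrt (by positivity)
  refine ⟨hp, hq, by positivity, by positivity, ?_, ?_⟩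
  · rw [← sq_eq_sq₀ (by positivity) (by positivity), mul_pow, mul_pow, hu, hv]
    field_simp
  · rw [hu, hv]
    field_simp
    ring

theorem IsWeight.symm {p q u v : ℝ} (h : IsWeight p q u v) : IsWeight q p v u :=
  ⟨h.pos_right, h.pos_left, h.nonneg_right, h.nonneg_left, h.balance.symm, by
    rw [add_comm]; exact h.norm⟩

theorem IsWeight.sq_right {p q u v : ℝ} (h : IsWeight p q u v) :
    v ^ 2 * ((p + q) * q) = p := by
  have h1 := h.balance
  have h2 := h.norm
  have : (u * p) ^ 2 = (v * q) ^ 2 := by rw [h1]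
  linear_combination p * h2 - this

/-- The Cauchy–Schwarz bound for a linear combination of three block sums of the noise. -/
theorem sq_block_le {p q R x a b c S₁ S₂ S₃ : ℝ}
    (h₁ : S₁ ^ 2 ≤ x ^ 2 * p) (h₂ : S₂ ^ 2 ≤ x ^ 2 * q) (h₃ : S₃ ^ 2 ≤ x ^ 2 * R) :
    (a * S₁ + b * S₂ + c * S₃) ^ 2 ≤ 3 * x ^ 2 * (a ^ 2 * p + b ^ 2 * q + c ^ 2 * R) := by
  have e₁ := mul_le_mul_of_nonneg_left h₁ (sq_nonneg a)
  have e₂ := mul_le_mul_of_nonneg_left h₂ (sq_nonneg b)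
  have e₃ := mul_le_mul_of_nonneg_left h₃ (sq_nonneg c)
  nlinarith [sq_nonneg (a * S₁ - b * S₂), sq_nonneg (a * S₁ - c * S₃),
    sq_nonneg (b * S₂ - c * S₃)]

/-- If a perturbed value `ρ F + E` is large and dominates `F + E'`, then `(1 - ρ) |F|` is at most
the difference of the perturbations. -/
theorem one_sub_mul_abs_le {F E E' ρ x : ℝ} (hρ : 0 ≤ ρ) (hE : |E| ≤ x)
    (hbig : x < |ρ * F + E|) (hmax : |F + E'| ≤ |ρ * F + E|) :
    (1 - ρ) * |F| ≤ |E - E'| := by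
  have hE' := abs_le.1 hE
  rcases le_total 0 F with hF | hF
  · have h1 : 0 ≤ ρ * F := mul_nonneg hρ hF
    have h2 : 0 ≤ ρ * F + E := by
      by_contra hneg
      rw [abs_of_neg (by linarith)] at hbig
      linarith
    rw [abs_of_nonneg h2] at hmax
    rw [abs_of_nonneg hF]
    have := le_abs_self (F + E')
    have := le_abs_self (E - E')
    linarith
  · have h1 : ρ * F ≤ 0 := mul_nonpos_of_nonneg_of_nonpos hρ hF
    have h2 : ρ * F + E ≤ 0 := by
      by_contra hneg
      rw [abs_of_pos (by linarith)] at hbig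
      linarith
    rw [abs_of_nonpos h2] at hmax
    rw [abs_of_nonpos hF]
    have := neg_le_abs (F + E')
    have := neg_le_abs (E - E')
    linarith

/-- Localization: three blocks of lengths `p`, `q`, `R`, the mean jumping by `D` between the second
and the third. If the contrast splitting after the first block is large and dominates the contrast
splitting at the jump, then the second block is short. -/
theorem block_le_of_contrast_le {p q R x D ζ m u v u' v' S₁ S₂ S₃ : ℝ} (hq : 0 ≤ q) (hx : 0 ≤ x)
    (hζ : 7 * x ≤ ζ) (hb : IsWeight p (q + R) u v) (hr : IsWeight (p + q) R u' v')
    (h₁ : S₁ ^ 2 ≤ x ^ 2 * p) (h₂ : S₂ ^ 2 ≤ x ^ 2 * q) (h₃ : S₃ ^ 2 ≤ x ^ 2 * R)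
    (hbig : ζ < |u * (p * m + S₁) - v * (q * m + S₂ + (R * (m + D) + S₃))|)
    (hmax : |u' * (p * m + S₁ + (q * m + S₂)) - v' * (R * (m + D) + S₃)|
      ≤ |u * (p * m + S₁) - v * (q * m + S₂ + (R * (m + D) + S₃))|) :
    q * D ^ 2 ≤ 24 * x ^ 2 := by
  have hp := hb.pos_left
  have hR := hr.pos_right
  set ρ := u * u' * p - v * u' * q + v * v' * R with hρdef
  set F := -(v' * R * D) with hF
  set E := u * S₁ + -v * S₂ + -v * S₃ with hE
  set E' := u' * S₁ + u' * S₂ + -v' * S₃ with hE'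
  have hb1 := hb.balance
  have hb2 := hb.norm
  have hr1 := hr.balance
  have hr2 := hr.norm
  have hρ : v = ρ * v' := by
    rw [hρdef]
    linear_combination (-v) * hr2 + v * u' * hr1 - u' * v' * hb1
  have hρ0 : 0 ≤ ρ := by
    have : ρ = v * R * (u' + v') := by rw [hρdef]; linear_combination u' * hb1
    rw [this]
    exact mul_nonneg (mul_nonneg hb.nonneg_right hR.le) (add_nonneg hr.nonneg_left hr.nonneg_right)
  have eb : u * (p * m + S₁) - v * (q * m + S₂ + (R * (m + D) + S₃)) = ρ * F + E := by
    rw [hF, hE]; linear_combination m * hb1 - R * D * hρ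
  have er : u' * (p * m + S₁ + (q * m + S₂)) - v' * (R * (m + D) + S₃) = F + E' := by
    rw [hF, hE']; linear_combination m * hr1
  rw [eb] at hbig hmax
  rw [er] at hmax
  have hEle : E ^ 2 ≤ 3 * x ^ 2 := by
    refine (sq_block_le h₁ h₂ h₃).trans_eq ?_
    linear_combination 3 * x ^ 2 * hb2
  have hEabs : |E| ≤ 2 * x := abs_le_of_sq_le_sq (by linarith [sq_nonneg x]) (by linarith)
  have key := one_sub_mul_abs_le hρ0 hEabs (by linarith) hmax
  -- The noise is applied to the difference of two unit vectors, whose squared norm is 2(1 - ρ).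
  -- This factor cancels one of the two factors 1 - ρ in the square of `key`, which is what gives
  -- the sharp rate.
  have hdiff : (E - E') ^ 2 ≤ 6 * x ^ 2 * (1 - ρ) := by
    have := sq_block_le (a := u - u') (b := -v - u') (c := -v + v') h₁ h₂ h₃
    calc (E - E') ^ 2 = ((u - u') * S₁ + (-v - u') * S₂ + (-v + v') * S₃) ^ 2 := by
          rw [hE, hE']; ring
      _ ≤ _ := this
      _ = _ := by rw [hρdef]; linear_combination 3 * x ^ 2 * (hb2 + hr2)
  have hρ1 : ρ ≤ 1 := by
    have h : 0 ≤ (u - u') ^ 2 * p + (-v - u') ^ 2 * q + (-v + v') ^ 2 * R := by positivity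
    have h' : (u - u') ^ 2 * p + (-v - u') ^ 2 * q + (-v + v') ^ 2 * R = 2 * (1 - ρ) := by
      rw [hρdef]; linear_combination hb2 + hr2
    linarith
  have hFsq : F ^ 2 * (1 - ρ) ≤ 6 * x ^ 2 := by
    rcases hρ1.eq_or_lt with h | h
    · rw [h, sub_self, mul_zero]; positivity
    · have h1 : ((1 - ρ) * |F|) ^ 2 ≤ |E - E'| ^ 2 :=
        pow_le_pow_left₀ (mul_nonneg (by linarith) (abs_nonneg _)) key 2
      rw [mul_pow, sq_abs, sq_abs] at h1
      have h2 : (1 - ρ) * (F ^ 2 * (1 - ρ)) ≤ (1 - ρ) * (6 * x ^ 2) := by linarith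
      exact le_of_mul_le_mul_left h2 (by linarith)
  have hF2 : F ^ 2 * (1 - ρ ^ 2) ≤ 12 * x ^ 2 := by
    have : F ^ 2 * (1 - ρ ^ 2) = (1 + ρ) * (F ^ 2 * (1 - ρ)) := by ring
    rw [this]
    have h0 : 0 ≤ F ^ 2 * (1 - ρ) := mul_nonneg (sq_nonneg _) (by linarith)
    linarith [mul_le_mul_of_nonneg_right (by linarith : 1 + ρ ≤ 2) h0]
  have hv := hb.sq_right
  have hv' := hr.sq_right
  -- As v = ρv', this evaluates the loss of signal energy F²(1 - ρ²) as D²qR/(q + R), independently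
  -- of p.
  have hvv : (v' ^ 2 - v ^ 2) * (R * (q + R)) = q := by
    have hl : (p + q + R) ≠ 0 := by positivity
    apply mul_left_cancel₀ hl
    linear_combination (q + R) * hv' - R * hv
  have hmain : R * q * D ^ 2 ≤ 12 * x ^ 2 * (q + R) := by
    have h1 : F ^ 2 * (1 - ρ ^ 2) = R ^ 2 * D ^ 2 * (v' ^ 2 - v ^ 2) := by
      rw [hF, hρ]; ring
    have h2 : R * q * D ^ 2 = F ^ 2 * (1 - ρ ^ 2) * (q + R) := by
      rw [h1]; linear_combination (-(R * D ^ 2)) * hvv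
    rw [h2]
    exact mul_le_mul_of_nonneg_right hF2 (by linarith)
  rcases le_total q R with hqR | hqR
  · have : R * (q * D ^ 2) ≤ R * (24 * x ^ 2) := by
      linarith [mul_le_mul_of_nonneg_left hqR (sq_nonneg x)]
    exact le_of_mul_le_mul_left this hR
  -- If R ≤ q, the energy bound controls R only: RD² ≤ 24x² forces |F| < 5x. But a contrast above ζ
  -- ≥ 7x with noise at most 2x needs |F| > 5x; this is the origin of the 7.
  · exfalso
    have hq0 : 0 < q := hR.trans_le hqR
    have h1 : R * D ^ 2 ≤ 24 * x ^ 2 := by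
      have : q * (R * D ^ 2) ≤ q * (24 * x ^ 2) := by
        linarith [mul_le_mul_of_nonneg_left hqR (sq_nonneg x)]
      exact le_of_mul_le_mul_left this hq0
    have h2 : F ^ 2 ≤ R * D ^ 2 := by
      have : v' ^ 2 * R ≤ 1 := by
        have : 0 ≤ u' ^ 2 * (p + q) := by positivity
        linarith
      have h3 : F ^ 2 = v' ^ 2 * R * (R * D ^ 2) := by rw [hF]; ring
      rw [h3]
      exact mul_le_of_le_one_left (by positivity) this
    have h4 : 5 * x < |F| := by
      have h5 := abs_add_le (ρ * F) E
      rw [abs_mul, abs_of_nonneg hρ0] at h5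
      have : ρ * |F| ≤ |F| := mul_le_of_le_one_left (abs_nonneg _) hρ1
      linarith
    have h5 : (5 * x) ^ 2 < |F| ^ 2 := pow_lt_pow_left₀ h4 (by linarith) two_ne_zero
    rw [sq_abs] at h5
    linarith [sq_nonneg x]

/-- Detection: the contrast splitting at a jump of size `D` with `w` observations on both sides. -/
theorem lt_abs_contrast {p R x D ζ m w u v S₁ S₃ : ℝ} (hx : 0 ≤ x)
    (hr : IsWeight p R u v) (hp : w ≤ p) (hR : w ≤ R)
    (h₁ : S₁ ^ 2 ≤ x ^ 2 * p) (h₃ : S₃ ^ 2 ≤ x ^ 2 * R)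
    (hbig : (ζ + 2 * x) ^ 2 < w / 2 * D ^ 2) :
    ζ < |u * (p * m + S₁) - v * (R * (m + D) + S₃)| := by
  have hp0 := hr.pos_left
  have hR0 := hr.pos_right
  have h1 := hr.balance
  have h2 := hr.norm
  have hv := hr.sq_right
  have e : u * (p * m + S₁) - v * (R * (m + D) + S₃)
      = -(v * R * D) + (u * S₁ + 0 * 0 + -v * S₃) := by linear_combination m * h1
  set E := u * S₁ + 0 * 0 + -v * S₃ with hE
  have hEle : E ^ 2 ≤ 3 * x ^ 2 := by
    refine (sq_block_le (S₂ := 0) (q := 0) h₁ (by simp) h₃).trans_eq ?_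
    linear_combination 3 * x ^ 2 * h2
  have hEabs : |E| ≤ 2 * x := abs_le_of_sq_le_sq (by linarith [sq_nonneg x]) (by linarith)
  -- The squared contrast of a unit jump is pR/(p + R), at least half the smaller of p and R.
  have hA : w / 2 ≤ (v * R) ^ 2 := by
    have h3 : (v * R) ^ 2 * (p + R) = p * R := by linear_combination R * hv
    have h4 : w / 2 * (p + R) ≤ (v * R) ^ 2 * (p + R) := by
      rw [h3]; nlinarith
    exact le_of_mul_le_mul_right h4 (by linarith)
  have hF : ζ + 2 * x < |v * R * D| := by
    apply lt_of_pow_lt_pow_left₀ 2 (abs_nonneg _)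
    rw [sq_abs, mul_pow]
    exact hbig.trans_le (mul_le_mul_of_nonneg_right hA (sq_nonneg _))
  rw [e]
  have h6 := abs_sub_abs_le_abs_sub (-(v * R * D)) (-E)
  rw [abs_neg, abs_neg, sub_neg_eq_add] at h6
  linarith

/-- Without a jump, the contrast is at most twice the noise level. -/
theorem abs_contrast_le {p R x m u v S₁ S₃ : ℝ} (hx : 0 ≤ x) (hr : IsWeight p R u v)
    (h₁ : S₁ ^ 2 ≤ x ^ 2 * p) (h₃ : S₃ ^ 2 ≤ x ^ 2 * R) :
    |u * (p * m + S₁) - v * (R * m + S₃)| ≤ 2 * x := by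
  have h2 := hr.norm
  have e : u * (p * m + S₁) - v * (R * m + S₃) = u * S₁ + 0 * 0 + -v * S₃ := by
    linear_combination m * hr.balance
  rw [e]
  have hEle : (u * S₁ + 0 * 0 + -v * S₃) ^ 2 ≤ 3 * x ^ 2 := by
    refine (sq_block_le (S₂ := 0) (q := 0) h₁ (by simp)
      h₃).trans_eq ?_
    linear_combination 3 * x ^ 2 * h2
  exact abs_le_of_sq_le_sq (by linarith [sq_nonneg x]) (by linarith)

/-! ### The contrast of a noisy signal -/

/-- All the block sums of `ε_1, …, ε_T` are at most `x` times the root of the block length. -/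
def NoiseBound (T : ℕ) (ε : ℕ → ℝ) (x : ℝ) : Prop :=
  ∀ s e : ℕ, 1 ≤ s → e ≤ T → s ≤ e + 1 →
    (∑ t ∈ Finset.Icc s e, ε t) ^ 2 ≤ x ^ 2 * ((e : ℝ) + 1 - s)

/-- The weights depend on the interval and the split only, not on the data, so the square roots can
be forgotten from here on. -/
theorem exists_isWeight_cusum {s e b : ℕ} (hs : s ≤ b) (he : b < e) :
    ∃ u v : ℝ, IsWeight ((b : ℝ) + 1 - s) ((e : ℝ) - b) u v ∧ ∀ X : ℕ → ℝ,
      cusum X s e b = |u * ∑ t ∈ Finset.Icc s b, X t - v * ∑ t ∈ Finset.Icc (b + 1) e, X t| := by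
  have h1 : (s : ℝ) ≤ b := by exact_mod_cast hs
  have h2 : (b : ℝ) < e := by exact_mod_cast he
  refine ⟨_, _, isWeight_sqrt (by linarith) (by linarith), fun X => ?_⟩
  have e1 : (e : ℝ) - s + 1 = (b + 1 - s) + (e - b) := by ring
  have e2 : (b : ℝ) - s + 1 = b + 1 - s := by ring
  rw [cusum, e1, e2]

theorem sum_Icc_add_noise {f ε : ℕ → ℝ} {s e : ℕ} {m : ℝ} (h : s ≤ e + 1)
    (hf : ∀ t ∈ Finset.Icc s e, f t = m) :
    ∑ t ∈ Finset.Icc s e, (f t + ε t) = ((e : ℝ) + 1 - s) * m + ∑ t ∈ Finset.Icc s e, ε t := by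
  rw [Finset.sum_add_distrib, Finset.sum_congr rfl hf, Finset.sum_const, Nat.card_Icc, nsmul_eq_mul,
    Nat.cast_sub h]
  push_cast
  rfl

theorem sum_Icc_split (X : ℕ → ℝ) {s b e : ℕ} (hs : s ≤ b + 1) (he : b ≤ e) :
    ∑ t ∈ Finset.Icc s e, X t = ∑ t ∈ Finset.Icc s b, X t + ∑ t ∈ Finset.Icc (b + 1) e, X t := by
  rw [← Finset.sum_union]
  · congr 1
    ext t
    simp only [Finset.mem_Icc, Finset.mem_union]
    omega
  · rw [Finset.disjoint_left]
    intro t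
    simp only [Finset.mem_Icc]
    omega

theorem cusum_le_of_const {T s e b : ℕ} {f ε : ℕ → ℝ} {x m : ℝ} (hx : 0 ≤ x)
    (hε : NoiseBound T ε x) (h1 : 1 ≤ s) (hs : s ≤ b) (he : b < e) (hT : e ≤ T)
    (hf : ∀ t ∈ Finset.Icc s e, f t = m) :
    cusum (fun t => f t + ε t) s e b ≤ 2 * x := by
  obtain ⟨u, v, hw, hc⟩ := exists_isWeight_cusum hs he
  rw [hc, sum_Icc_add_noise (m := m) (by omega), sum_Icc_add_noise (m := m) (by omega)]
  · have e1 : (e : ℝ) + 1 - ((b + 1 : ℕ) : ℝ) = e - b := by push_cast; ring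
    have n2 := hε (b + 1) e (by omega) hT (by omega)
    rw [e1] at n2 ⊢
    exact abs_contrast_le hx hw (hε s b h1 (by omega) (by omega)) n2
  all_goals
    intro t ht
    rw [Finset.mem_Icc] at ht
    exact hf t (Finset.mem_Icc.2 (by omega))

theorem lt_cusum_of_jump {T s e ρ : ℕ} {f ε : ℕ → ℝ} {x ζ w m D : ℝ} (hx : 0 ≤ x)
    (hε : NoiseBound T ε x) (h1 : 1 ≤ s) (hs : s ≤ ρ) (he : ρ < e) (hT : e ≤ T)
    (hl : ∀ t ∈ Finset.Icc s ρ, f t = m) (hr : ∀ t ∈ Finset.Icc (ρ + 1) e, f t = m + D)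
    (hwl : w ≤ (ρ : ℝ) + 1 - s) (hwr : w ≤ (e : ℝ) - ρ)
    (hbig : (ζ + 2 * x) ^ 2 < w / 2 * D ^ 2) :
    ζ < cusum (fun t => f t + ε t) s e ρ := by
  obtain ⟨u, v, hw, hc⟩ := exists_isWeight_cusum hs he
  rw [hc, sum_Icc_add_noise (by omega) hl, sum_Icc_add_noise (by omega) hr]
  have e1 : (e : ℝ) + 1 - ((ρ + 1 : ℕ) : ℝ) = e - ρ := by push_cast; ring
  have n2 := hε (ρ + 1) e (by omega) hT (by omega)
  rw [e1] at n2 ⊢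
  exact lt_abs_contrast hx hw hwl hwr (hε s ρ h1 (by omega) (by omega)) n2 hbig

theorem abs_sub_mul_sq_le {T s e ρ b : ℕ} {f ε : ℕ → ℝ} {x ζ m D : ℝ} (hx : 0 ≤ x)
    (hζ : 7 * x ≤ ζ) (hε : NoiseBound T ε x) (h1 : 1 ≤ s) (hs : s ≤ ρ) (he : ρ < e) (hT : e ≤ T)
    (hl : ∀ t ∈ Finset.Icc s ρ, f t = m) (hr : ∀ t ∈ Finset.Icc (ρ + 1) e, f t = m + D)
    (hsb : s ≤ b) (hbe : b < e) (hbig : ζ < cusum (fun t => f t + ε t) s e b)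
    (hmax : cusum (fun t => f t + ε t) s e ρ ≤ cusum (fun t => f t + ε t) s e b) :
    |(b : ℝ) - ρ| * D ^ 2 ≤ 24 * x ^ 2 := by
  obtain ⟨u, v, hw, hc⟩ := exists_isWeight_cusum hsb hbe
  obtain ⟨u', v', hw', hc'⟩ := exists_isWeight_cusum hs he
  rw [hc] at hbig hmax
  rw [hc'] at hmax
  rcases le_total b ρ with hbρ | hbρ
  · have hb' : (b : ℝ) ≤ ρ := by exact_mod_cast hbρ
    have A1 := sum_Icc_add_noise (ε := ε) (m := m) (f := f) (s := s) (e := b) (by omega)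
      (fun t ht => hl t (by rw [Finset.mem_Icc] at *; omega))
    have A2 := sum_Icc_add_noise (ε := ε) (m := m) (f := f) (s := b + 1) (e := ρ) (by omega)
      (fun t ht => hl t (by rw [Finset.mem_Icc] at *; omega))
    have A3 := sum_Icc_add_noise (ε := ε) (f := f) (by omega) hr
    have e2 : (ρ : ℝ) + 1 - ((b + 1 : ℕ) : ℝ) = ρ - b := by push_cast; ring
    have e3 : (e : ℝ) + 1 - ((ρ + 1 : ℕ) : ℝ) = e - ρ := by push_cast; ring
    have n1 := hε s b h1 (by omega) (by omega)
    -- This block is empty when b = ρ, which is why `NoiseBound` admits s = e + 1.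
    have n2 := hε (b + 1) ρ (by omega) (by omega) (by omega)
    have n3 := hε (ρ + 1) e (by omega) (by omega) (by omega)
    rw [e2] at A2 n2
    rw [e3] at A3 n3
    rw [sum_Icc_split _ (s := b + 1) (b := ρ) (e := e) (by omega) (by omega), A1, A2, A3]
      at hbig hmax
    rw [sum_Icc_split _ (s := s) (b := b) (e := ρ) (by omega) (by omega), A1, A2] at hmax
    rw [abs_sub_comm, abs_of_nonneg (by linarith)]
    refine block_le_of_contrast_le (by linarith) hx hζ ?_ ?_ n1 n2 n3 hbig hmax
    · convert hw using 1; ring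
    · convert hw' using 1; ring
  -- Time reversal: the blocks are taken from right to left, the base level is m + D, the jump is -D
  -- and the two weights exchange roles.
  · have hb' : (ρ : ℝ) ≤ b := by exact_mod_cast hbρ
    have A1 := sum_Icc_add_noise (ε := ε) (m := m + D) (f := f) (s := b + 1) (e := e) (by omega)
      (fun t ht => hr t (by rw [Finset.mem_Icc] at *; omega))
    have A2 := sum_Icc_add_noise (ε := ε) (m := m + D) (f := f) (s := ρ + 1) (e := b) (by omega)
      (fun t ht => hr t (by rw [Finset.mem_Icc] at *; omega))
    have A3 := sum_Icc_add_noise (ε := ε) (f := f) (by omega) hl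
    have hm : m = m + D + -D := by ring
    have e2 : (b : ℝ) + 1 - ((ρ + 1 : ℕ) : ℝ) = b - ρ := by push_cast; ring
    have e3 : (e : ℝ) + 1 - ((b + 1 : ℕ) : ℝ) = e - b := by push_cast; ring
    have n1 := hε (b + 1) e (by omega) (by omega) (by omega)
    have n2 := hε (ρ + 1) b (by omega) (by omega) (by omega)
    have n3 := hε s ρ h1 (by omega) (by omega)
    rw [e2] at A2 n2
    rw [e3] at A1 n1
    rw [sum_Icc_split _ (s := s) (b := ρ) (e := b) (by omega) (by omega), A1, A2, A3,
      abs_sub_comm (u * _)] at hbig hmax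
    rw [sum_Icc_split _ (s := ρ + 1) (b := b) (e := e) (by omega) (by omega), A1, A2,
      abs_sub_comm (u' * _)] at hmax
    rw [abs_of_nonneg (by linarith), ← neg_sq D]
    refine block_le_of_contrast_le (p := e - b) (R := ρ + 1 - s) (m := m + D)
      (by linarith) hx hζ ?_ ?_ n1 n2 n3 (u := v) (v := u) (u' := v') (v' := u') ?_ ?_
    · convert hw.symm using 1; ring
    · convert hw'.symm using 1; ring
    · rwa [← hm, add_comm (((b : ℝ) - ρ) * (m + D) + _)]
    · rwa [← hm, add_comm (((b : ℝ) - ρ) * (m + D) + _),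
        add_comm (((e : ℝ) - b) * (m + D) + _)]

/-! ### Piecewise constant signals -/

theorem IsPiecewiseConstant.monotoneOn {T N : ℕ} {r : ℕ → ℕ} {f : ℕ → ℝ}
    (h : IsPiecewiseConstant T N r f) : StrictMonoOn r (Set.Iic (N + 1)) :=
  strictMonoOn_of_lt_add_one Set.ordConnected_Iic fun j _ _ hj =>
    h.lt j (by simpa using hj)

theorem IsPiecewiseConstant.lt_of_lt {T N : ℕ} {r : ℕ → ℕ} {f : ℕ → ℝ}
    (h : IsPiecewiseConstant T N r f) {i j : ℕ} (hij : i < j) (hj : j ≤ N + 1) : r i < r j :=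
  h.monotoneOn (Set.mem_Iic.2 (by omega)) (Set.mem_Iic.2 hj) hij

theorem IsPiecewiseConstant.le_of_le {T N : ℕ} {r : ℕ → ℕ} {f : ℕ → ℝ}
    (h : IsPiecewiseConstant T N r f) {i j : ℕ} (hij : i ≤ j) (hj : j ≤ N + 1) : r i ≤ r j := by
  rcases hij.eq_or_lt with rfl | h'
  · exact le_rfl
  · exact (h.lt_of_lt h' hj).le

theorem IsPiecewiseConstant.index_lt {T N : ℕ} {r : ℕ → ℕ} {f : ℕ → ℝ}
    (h : IsPiecewiseConstant T N r f) {i j : ℕ} (hi : i ≤ N + 1) (hij : r i < r j) : i < j := by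
  by_contra hc
  exact absurd (h.le_of_le (not_lt.1 hc) hi) (by omega)

theorem IsPiecewiseConstant.eq_right {T N : ℕ} {r : ℕ → ℕ} {f : ℕ → ℝ}
    (h : IsPiecewiseConstant T N r f) {j t : ℕ} (hj : j ≤ N) (h1 : r j < t) (h2 : t ≤ r (j + 1)) :
    f t = f (r j) + (f (r j + 1) - f (r j)) := by
  rw [h.const j hj t h1 h2, h.const j hj (r j + 1) (by omega) (h.lt j hj)]
  ring

theorem IsPiecewiseConstant.eq_left {T N : ℕ} {r : ℕ → ℕ} {f : ℕ → ℝ}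
    (h : IsPiecewiseConstant T N r f) {j t : ℕ} (h0 : 1 ≤ j) (hj : j ≤ N) (h1 : r (j - 1) < t)
    (h2 : t ≤ r j) : f t = f (r j) := by
  have := h.const (j - 1) (by omega) t h1
  rw [Nat.sub_add_cancel h0] at this
  exact this h2

/-- The signal is constant on an interval without change-points. -/
theorem IsPiecewiseConstant.exists_const {T N : ℕ} {r : ℕ → ℕ} {f : ℕ → ℝ}
    (h : IsPiecewiseConstant T N r f) {s e : ℕ} (h1 : 1 ≤ s) (hT : e ≤ T)
    (hno : ∀ j, 1 ≤ j → j ≤ N → s ≤ r j → e ≤ r j) : ∃ m, ∀ t ∈ Finset.Icc s e, f t = m := by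
  classical
  have hlast := h.last
  by_cases hse : s ≤ e
  · have hex : ∃ j, s ≤ r j := ⟨N + 1, by omega⟩
    have hk := Nat.find_spec hex
    have hkle : Nat.find hex ≤ N + 1 := Nat.find_min' hex (by omega)
    have hk0 : Nat.find hex ≠ 0 := by
      intro h0
      rw [h0, h.zero] at hk
      omega
    obtain ⟨k, hkk⟩ := Nat.exists_eq_succ_of_ne_zero hk0
    have hlt : r k < s := not_le.1 (Nat.find_min hex (by omega))
    rw [hkk] at hk hkle
    have hek : e ≤ r (k + 1) := by
      rcases Nat.lt_or_ge N (k + 1) with hN | hN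
      · have : k + 1 = N + 1 := by omega
        rw [this]; omega
      · exact hno (k + 1) (by omega) hN hk
    refine ⟨f (r (k + 1)), fun t ht => ?_⟩
    rw [Finset.mem_Icc] at ht
    exact h.const k (by omega) t (by omega) (by omega)
  · exact ⟨0, fun t ht => by rw [Finset.mem_Icc] at ht; omega⟩

theorem minGap_le_gap (N : ℕ) (r : ℕ → ℕ) {j : ℕ} (hj : j ≤ N) : minGap N r ≤ gap r j :=
  ciInf_le (f := fun j : Fin (N + 1) => gap r j) (Set.finite_range _).bddBelow
    ⟨j, Nat.lt_succ_of_le hj⟩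

theorem minJump_le_jump (N : ℕ) (r : ℕ → ℕ) (f : ℕ → ℝ) {j : ℕ} (h1 : 1 ≤ j) (hj : j ≤ N) :
    minJump N r f ≤ jump r f j :=
  ciInf_le (f := fun j : Finset.Icc 1 N => jump r f j) (Set.finite_range _).bddBelow
    ⟨j, Finset.mem_Icc.2 ⟨h1, hj⟩⟩

theorem argmax_max (g : ℕ → ℝ) {a b u : ℕ} (hu : u ∈ Finset.Ico a b) : g u ≤ g (argmax g a b) := by
  obtain ⟨t, ht, hmax⟩ := Finset.exists_max_image (Finset.Ico a b) g ⟨u, hu⟩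
  exact (Nat.sInf_mem (s := {t | t ∈ Finset.Ico a b ∧ ∀ u ∈ Finset.Ico a b, g u ≤ g t})
    ⟨t, ht, hmax⟩).2 u hu

/-! ### The tested intervals -/

theorem leftPt_anti (lam s d : ℕ) {m k : ℕ} (h : m ≤ k) : leftPt lam s d k ≤ leftPt lam s d m :=
  max_le_max (Nat.sub_le_sub_left (Nat.mul_le_mul_right _ h) _) le_rfl

theorem rightPt_mono (lam e d : ℕ) {m k : ℕ} (h : m ≤ k) :
    rightPt lam e d m ≤ rightPt lam e d k :=
  min_le_min (Nat.sub_le_sub_right (Nat.add_le_add_left (Nat.mul_le_mul_right _ h) _) _) le_rfl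

/-- Together with `endPt_mono` this makes the tested intervals nested, so a detection no later than
the k-th test lies inside the k-th interval. -/
theorem startPt_anti (lam s e d : ℕ) {i j : ℕ} (h : i ≤ j) :
    startPt lam s e d j ≤ startPt lam s e d i := by
  unfold startPt
  split_ifs <;> exact leftPt_anti _ _ _ (by omega)

theorem endPt_mono (lam s e d : ℕ) {i j : ℕ} (h : i ≤ j) :
    endPt lam s e d i ≤ endPt lam s e d j := by
  unfold endPt
  split_ifs <;> exact rightPt_mono _ _ _ (by omega)

theorem le_numLeft_mul {lam s d : ℕ} (hlam : 1 ≤ lam) : d + 1 ≤ s + numLeft lam s d * lam := by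
  have h0 : (0 : ℝ) < lam := by exact_mod_cast hlam
  have h := (div_le_iff₀ h0).1 (Nat.le_ceil (((d : ℝ) - s + 1) / lam))
  have h' : (d : ℝ) + 1 ≤ s + numLeft lam s d * lam := by
    unfold numLeft
    linarith
  exact_mod_cast h'

theorem le_numRight_mul {lam e d : ℕ} (hlam : 1 ≤ lam) : e + 1 ≤ d + numRight lam e d * lam := by
  have h0 : (0 : ℝ) < lam := by exact_mod_cast hlam
  have h := (div_le_iff₀ h0).1 (Nat.le_ceil (((e : ℝ) - d + 1) / lam))
  have h' : (e : ℝ) + 1 ≤ d + numRight lam e d * lam := by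
    unfold numRight
    linarith
  exact_mod_cast h'

theorem leftPt_of_numLeft_le {lam s d m : ℕ} (hlam : 1 ≤ lam) (h : numLeft lam s d ≤ m) :
    leftPt lam s d m = s := by
  have h1 := le_numLeft_mul (s := s) (d := d) hlam
  have h2 := Nat.mul_le_mul_right lam h
  unfold leftPt
  omega

theorem rightPt_of_numRight_le {lam e d m : ℕ} (hlam : 1 ≤ lam) (h : numRight lam e d ≤ m) :
    rightPt lam e d m = e := by
  have h1 := le_numRight_mul (e := e) (d := d) hlam
  have h2 := Nat.mul_le_mul_right lam h
  unfold rightPt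
  omega

/-- After `m` expansions on both sides, the tested interval is `[c^l_m, c^r_m]`; once `[s, e]` is
exhausted, this is `[s, e]` itself. -/
theorem exists_symmetric_interval {lam s e d m : ℕ} (hlam : 1 ≤ lam) (hs : s ≤ d) (hm : 1 ≤ m) :
    ∃ j, 1 ≤ j ∧ j ≤ numIntervals lam s e d ∧ startPt lam s e d j = leftPt lam s d m ∧
      endPt lam s e d j = rightPt lam e d m := by
  have hL : 1 ≤ numLeft lam s d := by
    have h1 := le_numLeft_mul (s := s) (d := d) hlam
    by_contra h
    have h0 : numLeft lam s d = 0 := by omega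
    rw [h0] at h1
    omega
  -- Beyond K^max expansions both ends have already reached s and e, so m may be lowered to K^max.
  have hcase : ∃ m', 1 ≤ m' ∧ m' ≤ max (numLeft lam s d) (numRight lam e d) ∧
      leftPt lam s d m' = leftPt lam s d m ∧ rightPt lam e d m' = rightPt lam e d m := by
    by_cases h : m ≤ max (numLeft lam s d) (numRight lam e d)
    · exact ⟨m, hm, h, rfl, rfl⟩
    · refine ⟨max (numLeft lam s d) (numRight lam e d), by omega, le_rfl, ?_, ?_⟩
      · rw [leftPt_of_numLeft_le hlam (le_max_left _ _), leftPt_of_numLeft_le hlam (by omega)]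
      · rw [rightPt_of_numRight_le hlam (le_max_right _ _), rightPt_of_numRight_le hlam (by omega)]
  obtain ⟨m', h1, h2, h3, h4⟩ := hcase
  rw [← h3, ← h4]
  unfold startPt endPt numIntervals
  by_cases h : m' ≤ min (numLeft lam s d) (numRight lam e d)
  -- In the alternating phase the symmetric intervals sit at even positions; after position 2K^min
  -- each step is symmetric, at position m' + K^min.
  · refine ⟨2 * m', by omega, by omega, ?_, ?_⟩
    · rw [if_pos (by omega)]
      congr 1
      omega
    · rw [if_pos (by omega)]
      congr 1
      omega
  · refine ⟨m' + min (numLeft lam s d) (numRight lam e d), by omega, by omega, ?_, ?_⟩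
    · rw [if_neg (by omega), Nat.add_sub_cancel]
    · rw [if_neg (by omega), Nat.add_sub_cancel]

theorem le_testStart (X : ℕ → ℝ) (lam s e j : ℕ) : s ≤ testStart X lam s e j := by
  unfold testStart startPt leftPt
  split_ifs <;> exact le_max_right _ _

theorem testEnd_le (X : ℕ → ℝ) (lam s e j : ℕ) : testEnd X lam s e j ≤ e := by
  unfold testEnd endPt rightPt
  split_ifs <;> exact min_le_right _ _

theorem detects_of_firstDetection {X : ℕ → ℝ} {lam : ℕ} {ζ : ℝ} {s e j : ℕ}
    (h : firstDetection X lam ζ s e = some j) : Detects X lam ζ s e j := by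
  classical
  unfold firstDetection at h
  split_ifs at h with h1 h2
  obtain rfl := Option.some.inj h
  exact (Nat.find_spec h2).2.2

theorem exists_firstDetection_le {X : ℕ → ℝ} {lam : ℕ} {ζ : ℝ} {s e k : ℕ} (hse : s + 3 ≤ e)
    (hk : 1 ≤ k) (hk' : k ≤ numIntervals lam s e (largestDiff X s e))
    (hd : Detects X lam ζ s e k) : ∃ i ≤ k, firstDetection X lam ζ s e = some i := by
  classical
  have hex : ∃ j, 1 ≤ j ∧ j ≤ numIntervals lam s e (largestDiff X s e) ∧ Detects X lam ζ s e j :=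
    ⟨k, hk, hk', hd⟩
  refine ⟨Nat.find hex, Nat.find_min' hex ⟨hk, hk', hd⟩, ?_⟩
  unfold firstDetection
  rw [if_neg (by omega), dif_pos hex]

theorem detects_of_lt_cusum {X : ℕ → ℝ} {lam : ℕ} {ζ : ℝ} {s e j b : ℕ}
    (h1 : testStart X lam s e j ≤ b) (h2 : b < testEnd X lam s e j)
    (h : ζ < cusum X (testStart X lam s e j) (testEnd X lam s e j) b) : Detects X lam ζ s e j :=
  ⟨by omega, h.trans_le (argmax_max _ (Finset.mem_Ico.2 ⟨h1, h2⟩))⟩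

/-! ### The deterministic analysis -/

/-- The noise is bounded by `x` at every scale, the threshold is large with respect to `x`, and all
change-points are well separated (at the scale `y`) and large with respect to the threshold. -/
structure Regime (T N : ℕ) (r : ℕ → ℕ) (f ε : ℕ → ℝ) (lam : ℕ) (x ζ y : ℝ) : Prop where
  piecewise : IsPiecewiseConstant T N r f
  noise : NoiseBound T ε x
  noise_nonneg : 0 ≤ x
  threshold : 7 * x ≤ ζ
  one_le : 1 ≤ lam
  expansion_le : (lam : ℝ) ≤ y
  gap_ge : ∀ j ≤ N, 3 * y ≤ gap r j
  jump_ge : ∀ j, 1 ≤ j → j ≤ N → (ζ + 2 * x) ^ 2 < y / 2 / 2 * jump r f j ^ 2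

/-- Every change-point in `[s, e]` is far from the end-points. -/
def Isolated (N : ℕ) (r : ℕ → ℕ) (y : ℝ) (s e : ℕ) : Prop :=
  ∀ j, 1 ≤ j → j ≤ N → s ≤ r j → r j < e →
    s + 2 ≤ r j ∧ y / 2 ≤ (r j : ℝ) + 1 - s ∧ y / 2 ≤ (e : ℝ) - r j

/-- `d` is closer to some `r i` than to its neighbours, by a margin `3 y / 2` from the mid-points,
except that nothing is required to the left of `r 1` and to the right of `r N`. -/
def NearChange (N : ℕ) (r : ℕ → ℕ) (y : ℝ) (d : ℕ) : Prop :=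
  ∃ i, 1 ≤ i ∧ i ≤ N ∧ (i = 1 ∨ (r i : ℝ) - gap r (i - 1) / 2 + 3 / 2 * y ≤ d) ∧
    (i = N ∨ (d : ℝ) ≤ r i + gap r i / 2 - 3 / 2 * y)

section
variable {T N : ℕ} {r : ℕ → ℕ} {f ε : ℕ → ℝ} {lam : ℕ} {x ζ y : ℝ}

theorem Regime.gap_ge' (h : Regime T N r f ε lam x ζ y) {j : ℕ} (hj : j ≤ N) :
    (r j : ℝ) + 3 * y ≤ r (j + 1) := by
  have := h.gap_ge j hj
  unfold gap at this
  linarith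

theorem Regime.one_le_scale (h : Regime T N r f ε lam x ζ y) : 1 ≤ y :=
  le_trans (by exact_mod_cast h.one_le) h.expansion_le

/-- An interval in which a change-point is declared does contain a change-point. -/
theorem Regime.exists_change_of_detects (h : Regime T N r f ε lam x ζ y) {s e j : ℕ} (h1 : 1 ≤ s)
    (hT : e ≤ T) (hd : Detects (fun t => f t + ε t) lam ζ s e j) :
    ∃ i, 1 ≤ i ∧ i ≤ N ∧ testStart (fun t => f t + ε t) lam s e j ≤ r i ∧
      r i < testEnd (fun t => f t + ε t) lam s e j := by
  by_contra! hno
  have hs := le_testStart (fun t => f t + ε t) lam s e j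
  have he := testEnd_le (fun t => f t + ε t) lam s e j
  obtain ⟨m, hm⟩ := h.piecewise.exists_const (h1.trans hs) (he.trans hT) hno
  have hb := Finset.mem_Ico.1 (argmax_mem (cusum (fun t => f t + ε t)
    (testStart (fun t => f t + ε t) lam s e j) (testEnd (fun t => f t + ε t) lam s e j)) hd.1)
  have h2 := cusum_le_of_const h.noise_nonneg h.noise (h1.trans hs) hb.1 hb.2 (he.trans hT) hm
  have h3 := hd.2
  have h4 := h.threshold
  have h5 := h.noise_nonneg
  unfold testLoc at h3
  linarith

/-- The change-point reached first when expanding around `d`. -/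
theorem Regime.exists_nearest (h : Regime T N r f ε lam x ζ y) {s e d i₀ : ℕ}
    (hs : s ≤ d) (he : d < e) (hi₁ : 1 ≤ i₀) (hi₀ : i₀ ≤ N) (hsi : s ≤ r i₀) (hei : r i₀ < e)
    (hd : NearChange N r y d) :
    ∃ j, 1 ≤ j ∧ j ≤ N ∧ s ≤ r j ∧ r j < e ∧
      (j = 1 ∨ r (j - 1) < s ∨ |(d : ℝ) - r j| + 3 * y ≤ d - r (j - 1)) ∧
      (j = N ∨ e ≤ r (j + 1) ∨ |(d : ℝ) - r j| + 3 * y ≤ r (j + 1) - d) := by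
  have hf := h.piecewise
  have hy := h.one_le_scale
  obtain ⟨i, h1, hN, hl, hr⟩ := hd
  obtain ⟨k, rfl⟩ : ∃ k, i = k + 1 := ⟨i - 1, by omega⟩
  simp only [Nat.add_sub_cancel, gap] at hl hr
  have hgl := h.gap_ge' (j := k) (by omega)
  have hgr := h.gap_ge' (j := k + 1) hN
  by_cases hsi' : s ≤ r (k + 1)
  · by_cases hei' : r (k + 1) < e
    · refine ⟨k + 1, h1, hN, hsi', hei', ?_, ?_⟩
      · refine hl.imp_right fun hl => Or.inr ?_
        rw [Nat.add_sub_cancel]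
        rcases abs_cases ((d : ℝ) - r (k + 1)) with ⟨h', _⟩ | ⟨h', _⟩ <;> rw [h'] <;> linarith
      · refine hr.imp_right fun hr => Or.inr ?_
        rcases abs_cases ((d : ℝ) - r (k + 1)) with ⟨h', _⟩ | ⟨h', _⟩ <;> rw [h'] <;> linarith
    -- Here the change-point next to d lies at or beyond e. Its left neighbour takes over: it is in
    -- [s, e], d lies to its right, and nothing else to its right is in the interval. The case of a
    -- change-point before s is symmetric.
    · have hlt := hf.index_lt (i := i₀) (j := k + 1) (by omega) (by omega)
      obtain ⟨k, rfl⟩ : ∃ k', k = k' + 1 := ⟨k - 1, by omega⟩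
      have hl' := hl.resolve_left (by omega)
      have hkd : (r (k + 1) : ℝ) < d := by linarith
      have hkd' : r (k + 1) < d := by exact_mod_cast hkd
      have hik := hf.le_of_le (i := i₀) (j := k + 1) (by omega) (by omega)
      have hg := h.gap_ge' (j := k) (by omega)
      refine ⟨k + 1, by omega, by omega, by omega, by omega, Or.inr (Or.inr ?_),
        Or.inr (Or.inl (by omega))⟩
      rw [Nat.add_sub_cancel, abs_of_pos (by linarith)]
      linarith
  · have hlt := hf.index_lt (i := k + 1) (j := i₀) (by omega) (by omega)
    have hr' := hr.resolve_left (by omega)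
    have hkd : (d : ℝ) < r (k + 1 + 1) := by linarith
    have hkd' : d < r (k + 1 + 1) := by exact_mod_cast hkd
    have hik := hf.le_of_le (i := k + 1 + 1) (j := i₀) (by omega) (by omega)
    have hg := h.gap_ge' (j := k + 1 + 1) (by omega)
    refine ⟨k + 1 + 1, by omega, by omega, by omega, by omega,
      Or.inr (Or.inl (by rw [Nat.add_sub_cancel]; omega)), Or.inr (Or.inr ?_)⟩
    rw [abs_of_neg (by linarith)]
    linarith

/-- In an interval with an admissible largest difference, the first detection isolates exactly one
change-point, which is accurately located, and leaves the other ones isolated. -/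
theorem Regime.exists_detection (h : Regime T N r f ε lam x ζ y) {s e i₀ : ℕ}
    (hs1 : 1 ≤ s) (heT : e ≤ T) (hi₁ : 1 ≤ i₀) (hi₀ : i₀ ≤ N) (hsi : s ≤ r i₀) (hei : r i₀ < e)
    (hiso : Isolated N r y s e) (hd : NearChange N r y (largestDiff (fun t => f t + ε t) s e)) :
    ∃ i j, firstDetection (fun t => f t + ε t) lam ζ s e = some i ∧ 1 ≤ j ∧ j ≤ N ∧
      testStart (fun t => f t + ε t) lam s e i ≤ r j ∧
      r j < testEnd (fun t => f t + ε t) lam s e i ∧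
      Isolated N r y s (testStart (fun t => f t + ε t) lam s e i) ∧
      Isolated N r y (testEnd (fun t => f t + ε t) lam s e i) e ∧
      r (j - 1) < testStart (fun t => f t + ε t) lam s e i ∧
      testEnd (fun t => f t + ε t) lam s e i ≤ r (j + 1) ∧
      |(testLoc (fun t => f t + ε t) lam s e i : ℝ) - r j| * jump r f j ^ 2 ≤ 24 * x ^ 2 := by
  have hf := h.piecewise
  have hy := h.one_le_scale
  have hlam := h.one_le
  have hlamy := h.expansion_le
  set X : ℕ → ℝ := fun t => f t + ε t with hX
  have hse : s + 3 ≤ e := by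
    have := (hiso i₀ hi₁ hi₀ hsi hei).1
    omega
  have hdmem := Finset.mem_Ico.1
    (argmax_mem (fun t => |X (t + 1) - X t|) (show s < e by omega))
  change s ≤ largestDiff X s e ∧ largestDiff X s e < e at hdmem
  obtain ⟨j, hj1, hjN, hsj, hje, hleft, hright⟩ :=
    h.exists_nearest hdmem.1 hdmem.2 hi₁ hi₀ hsi hei hd
  obtain ⟨-, hisoL, hisoR⟩ := hiso j hj1 hjN hsj hje
  set d := largestDiff X s e with hddef
  set D : ℝ := |(d : ℝ) - r j| with hD
  have hDl : -D ≤ (d : ℝ) - r j := neg_abs_le _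
  have hDr : (d : ℝ) - r j ≤ D := le_abs_self _
  have hlam0 : (0 : ℝ) < lam := by exact_mod_cast hlam
  have hD0 : 0 ≤ D := abs_nonneg _
  -- The least number of expansions whose half-width m·lam reaches D + y/2 + 1. It overshoots by
  -- less than lam ≤ y, so the interval stops short of the neighbours, which are at distance at
  -- least D + 3y from d unless outside [s, e].
  set m := ⌈(D + y / 2 + 1) / lam⌉₊ with hm
  have hm1 : 1 ≤ m := Nat.one_le_ceil_iff.2 (by positivity)
  have hmlo : D + y / 2 + 1 ≤ m * lam := (div_le_iff₀ hlam0).1 (Nat.le_ceil _)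
  have hmhi : (m : ℝ) * lam < D + y / 2 + 1 + lam := by
    have h1 := Nat.ceil_lt_add_one (show 0 ≤ (D + y / 2 + 1) / lam by positivity)
    have h2 := mul_lt_mul_of_pos_right h1 hlam0
    rw [add_mul, div_mul_cancel₀ _ hlam0.ne', one_mul] at h2
    exact h2
  obtain ⟨k, hk1, hkK, hkL, hkR⟩ := exists_symmetric_interval (e := e) hlam hdmem.1 hm1
  have hP : ((m * lam : ℕ) : ℝ) = m * lam := by push_cast; rfl
  have hLs : s ≤ leftPt lam s d m := le_max_right _ _
  have hRe : rightPt lam e d m ≤ e := min_le_right _ _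
  have hL1 : d ≤ leftPt lam s d m + m * lam := by unfold leftPt; omega
  have hR1 : rightPt lam e d m + 1 ≤ d + m * lam := by
    have : 1 ≤ m * lam := Nat.mul_pos hm1 hlam
    unfold rightPt
    omega
  have hL2 : leftPt lam s d m = s ∨ leftPt lam s d m + m * lam = d := by unfold leftPt; omega
  have hR2 : rightPt lam e d m = e ∨ rightPt lam e d m + 1 = d + m * lam := by
    have : 1 ≤ m * lam := Nat.mul_pos hm1 hlam
    unfold rightPt
    omega
  clear_value m
  set L := leftPt lam s d m with hLdef
  set R := rightPt lam e d m with hRdef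
  clear_value L R
  have hL1' : (d : ℝ) ≤ L + m * lam := by rw [← hP]; exact_mod_cast hL1
  have hR1' : (R : ℝ) + 1 ≤ d + m * lam := by rw [← hP]; exact_mod_cast hR1
  have hcountL : y / 2 ≤ (r j : ℝ) + 1 - L := by
    rcases hL2 with hL2 | hL2
    · rw [hL2]; exact hisoL
    · have : (L : ℝ) + m * lam = d := by rw [← hP]; exact_mod_cast hL2
      linarith
  have hcountR : y / 2 ≤ (R : ℝ) - r j := by
    rcases hR2 with hR2 | hR2
    · rw [hR2]; exact hisoR
    · have : (R : ℝ) + 1 = d + m * lam := by rw [← hP]; exact_mod_cast hR2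
      linarith
  have hLj : L ≤ r j := by
    have : (L : ℝ) < r j + 1 := by linarith
    exact Nat.lt_succ_iff.1 (by exact_mod_cast this)
  have hjR : r j < R := by
    have : (r j : ℝ) < R := by linarith
    exact_mod_cast this
  have hpred : j - 1 + 1 = j := by omega
  -- The left margin exceeds 3y - (y/2 + 1 + y) = 3y/2 - 1, which is at least y/2 because y ≥ 1.
  have hprev : r (j - 1) < s ∨ y / 2 ≤ (L : ℝ) - r (j - 1) := by
    rcases hleft with rfl | hl | hl
    · left
      rw [Nat.sub_self, hf.zero]
      omega
    · exact Or.inl hl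
    · right
      linarith
  have hnext : e ≤ r (j + 1) ∨ (3 / 2 * y + 1 < (r (j + 1) : ℝ) + 1 - R) := by
    rcases hright with rfl | hr | hr
    · left
      rw [hf.last]
      omega
    · exact Or.inl hr
    · right
      linarith
  have hprevL : r (j - 1) < L := by
    rcases hprev with hl | hl
    · omega
    · have : (r (j - 1) : ℝ) < L := by linarith
      exact_mod_cast this
  have hnextR : R ≤ r (j + 1) := by
    rcases hnext with hr | hr
    · omega
    · have : (R : ℝ) < r (j + 1) := by linarith
      exact_mod_cast this.le
  have hDet : Detects X lam ζ s e k := by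
    have e1 : testStart X lam s e k = L := hkL
    have e2 : testEnd X lam s e k = R := hkR
    refine detects_of_lt_cusum (b := r j) (by omega) (by omega) ?_
    rw [e1, e2]
    refine lt_cusum_of_jump h.noise_nonneg h.noise (hs1.trans hLs) hLj hjR (hRe.trans heT)
      (m := f (r j)) (D := f (r j + 1) - f (r j)) (w := y / 2) ?_ ?_ hcountL hcountR ?_
    · intro t ht
      rw [Finset.mem_Icc] at ht
      exact hf.eq_left hj1 hjN (by omega) ht.2
    · intro t ht
      rw [Finset.mem_Icc] at ht
      exact hf.eq_right hjN (by omega) (by omega)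
    · have := h.jump_ge j hj1 hjN
      rwa [jump, sq_abs] at this
  obtain ⟨i, hik, hi⟩ := exists_firstDetection_le hse hk1 hkK hDet
  have hDi := detects_of_firstDetection hi
  have hsL : L ≤ testStart X lam s e i := by rw [← hkL]; exact startPt_anti _ _ _ _ hik
  have heR : testEnd X lam s e i ≤ R := by rw [← hkR]; exact endPt_mono _ _ _ _ hik
  obtain ⟨j', hj1', hjN', hsj', hje'⟩ := h.exists_change_of_detects hs1 heT hDi
  rw [← hX] at hsj' hje'
  -- The detected interval contains some change-point and lies in [L, R], where `r j` is the only
  -- one.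
  obtain rfl : j' = j := by
    have h1 := hf.index_lt (i := j - 1) (j := j') (by omega) (by omega)
    have h2 := hf.index_lt (i := j') (j := j + 1) (by omega) (by omega)
    omega
  refine ⟨i, j', hi, hj1, hjN, hsj', hje', ?_, ?_, by omega, by omega, ?_⟩
  · intro q hq1 hqN hsq hqe
    have hq := hiso q hq1 hqN hsq (by omega)
    refine ⟨hq.1, hq.2.1, ?_⟩
    have h1 := hf.index_lt (i := q) (j := j') (by omega) (by omega)
    have h2 := hf.le_of_le (i := q) (j := j' - 1) (by omega) (by omega)
    have h3 := hprev.resolve_left (by omega)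
    have h4 : (L : ℝ) ≤ testStart X lam s e i := by exact_mod_cast hsL
    have h5 : (r q : ℝ) ≤ r (j' - 1) := by exact_mod_cast h2
    linarith
  · intro q hq1 hqN hsq hqe
    have hq := hiso q hq1 hqN (by omega) hqe
    have h1 := hf.index_lt (i := j') (j := q) (by omega) (by omega)
    have h2 := hf.le_of_le (i := j' + 1) (j := q) (by omega) (by omega)
    have h3 := hnext.resolve_left (by omega)
    have h4 : (testEnd X lam s e i : ℝ) ≤ R := by exact_mod_cast heR
    have h5 : (r (j' + 1) : ℝ) ≤ r q := by exact_mod_cast h2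
    -- The margin 3y/2 > 1 gives the two-point clearance in `Isolated`, so an interval holding a
    -- change-point has e - s ≥ 3 and is not abandoned as too short.
    refine ⟨?_, by linarith, hq.2.2⟩
    have h6 : (testEnd X lam s e i : ℝ) + 1 < r q := by linarith
    have h7 : testEnd X lam s e i + 1 < r q := by exact_mod_cast h6
    omega
  · have hb := Finset.mem_Ico.1 (argmax_mem (cusum X
      (testStart X lam s e i) (testEnd X lam s e i)) hDi.1)
    have hs' := le_testStart X lam s e i
    have he' := testEnd_le X lam s e i
    rw [jump, sq_abs]
    refine abs_sub_mul_sq_le (m := f (r j')) h.noise_nonneg h.threshold h.noise (hs1.trans hs') hsj'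
      hje' (he'.trans heT) ?_ ?_ hb.1 hb.2 hDi.2 (argmax_max _ (Finset.mem_Ico.2 ⟨hsj', hje'⟩))
    · intro t ht
      rw [Finset.mem_Icc] at ht
      exact hf.eq_left hj1 hjN (by omega) ht.2
    · intro t ht
      rw [Finset.mem_Icc] at ht
      exact hf.eq_right hjN (by omega) (by omega)

/-- The estimates produced from `[s, e]` match the change-points in `[s, e]`. -/
theorem Regime.forall₂_dais (h : Regime T N r f ε lam x ζ y)
    (hadm : ∀ s e, IsCall (fun t => f t + ε t) lam ζ T s e → s + 3 ≤ e →
      (∃ j, 1 ≤ j ∧ j ≤ N ∧ s ≤ r j ∧ r j < e) →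
        NearChange N r y (largestDiff (fun t => f t + ε t) s e)) (s e : ℕ)
    (hcall : IsCall (fun t => f t + ε t) lam ζ T s e) (hs1 : 1 ≤ s) (heT : e ≤ T)
    (hiso : Isolated N r y s e) (a k : ℕ) (ha : 1 ≤ a) (hk : a + k ≤ N + 1)
    (hmem : ∀ j, 1 ≤ j → j ≤ N → ((s ≤ r j ∧ r j < e) ↔ (a ≤ j ∧ j < a + k))) :
    List.Forall₂ (fun b j : ℕ => |(b : ℝ) - r j| * jump r f j ^ 2 ≤ 24 * x ^ 2)
      (dais (fun t => f t + ε t) lam ζ s e) (List.range' a k) := by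
  have hf := h.piecewise
  induction hn : e - s using Nat.strong_induction_on generalizing s e a k with
  | _ n ih =>
  rcases Nat.eq_zero_or_pos k with rfl | hkpos
  · rw [dais]
    split
    · simp
    · next i hi =>
      exfalso
      obtain ⟨j, hj1, hjN, hsj, hje⟩ :=
        h.exists_change_of_detects hs1 heT (detects_of_firstDetection hi)
      have := (hmem j hj1 hjN).1 ⟨(le_testStart _ _ _ _ _).trans hsj,
        hje.trans_le (testEnd_le _ _ _ _ _)⟩
      omega
  · obtain ⟨hsa, hae⟩ := (hmem a ha (by omega)).2 ⟨le_rfl, by omega⟩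
    have hse : s + 3 ≤ e := by
      have := (hiso a ha (by omega) hsa hae).1
      omega
    obtain ⟨i, j, hi, hj1, hjN, hsj, hje, hisoL, hisoR, hprev, hnext, hacc⟩ :=
      h.exists_detection hs1 heT ha (by omega) hsa hae hiso
        (hadm s e hcall hse ⟨a, ha, by omega, hsa, hae⟩)
    have hbd := firstDetection_bounds hi
    obtain ⟨haj, hjk⟩ := (hmem j hj1 hjN).1 ⟨by omega, by omega⟩
    rw [dais]
    split
    · next hnone => rw [hi] at hnone; cases hnone
    · next i' hi' =>
      obtain rfl : i = i' := by rw [hi] at hi'; exact Option.some.inj hi'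
      -- The isolated change-point `r j` splits the indices as the recursion splits the estimates:
      -- smaller ones on the left, larger ones on the right.
      have hrange : List.range' a k =
          List.range' a (j - a) ++ j :: List.range' (j + 1) (a + k - (j + 1)) := by
        rw [← List.range'_succ]
        have e1 : k = (j - a) + (a + k - (j + 1) + 1) := by omega
        have e2 : a + (j - a) = j := by omega
        conv_lhs => rw [e1, ← List.range'_append_1, e2]
      rw [hrange]
      refine List.rel_append ?_ (List.Forall₂.cons hacc ?_)
      · refine ih _ (by omega) _ _ (hcall.left hi) hs1 (by omega) hisoL a (j - a) ha (by omega)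
          ?_ rfl
        intro q hq1 hqN
        constructor
        · rintro ⟨h1, h2⟩
          have := (hmem q hq1 hqN).1 ⟨h1, by omega⟩
          have := hf.index_lt (i := q) (j := j) (by omega) (by omega)
          omega
        · rintro ⟨h1, h2⟩
          have := (hmem q hq1 hqN).2 ⟨h1, by omega⟩
          have := hf.le_of_le (i := q) (j := j - 1) (by omega) (by omega)
          omega
      · refine ih _ (by omega) _ _ (hcall.right hi) (by omega) heT hisoR (j + 1) _ (by omega)
          (by omega) ?_ rfl
        intro q hq1 hqN
        constructor
        · rintro ⟨h1, h2⟩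
          have := (hmem q hq1 hqN).1 ⟨by omega, h2⟩
          have := hf.index_lt (i := j) (j := q) (by omega) (by omega)
          omega
        · rintro ⟨h1, h2⟩
          have := (hmem q hq1 hqN).2 ⟨by omega, by omega⟩
          have := hf.le_of_le (i := j + 1) (j := q) (by omega) (by omega)
          omega

/-- The induction starts on [1, T], whose change-points are isolated because the first and last gaps
are at least 3y ≥ 3. -/
theorem Regime.accurate (h : Regime T N r f ε lam x ζ y)
    (hadm : ∀ s e, IsCall (fun t => f t + ε t) lam ζ T s e → s + 3 ≤ e →
      (∃ j, 1 ≤ j ∧ j ≤ N ∧ s ≤ r j ∧ r j < e) →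
        NearChange N r y (largestDiff (fun t => f t + ε t) s e)) :
    Accurate T N r f (fun t => f t + ε t) lam ζ (24 * x ^ 2) := by
  have hf := h.piecewise
  have hy := h.one_le_scale
  have hz : (r 0 : ℝ) = 0 := by rw [hf.zero]; simp
  have hiso : Isolated N r y 1 T := by
    intro j hj1 hjN _ _
    have g0 := h.gap_ge' (j := 0) (by omega)
    have gN := h.gap_ge' le_rfl
    rw [hf.last] at gN
    have h1 : (r (0 + 1) : ℝ) ≤ r j := by exact_mod_cast hf.le_of_le (by omega) (by omega)
    have h2 : (r j : ℝ) ≤ r N := by exact_mod_cast hf.le_of_le hjN (by omega)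
    refine ⟨?_, by push_cast; linarith, by linarith⟩
    have h3 : ((1 + 2 : ℕ) : ℝ) ≤ r j := by push_cast; linarith
    exact_mod_cast h3
  have hall := h.forall₂_dais hadm 1 T IsCall.start le_rfl le_rfl hiso 1 N le_rfl (by omega)
    (fun j hj1 hjN => by
      have h1 := hf.lt_of_lt (i := 0) (j := j) (by omega) (by omega)
      have h2 := hf.lt_of_lt (i := j) (j := N + 1) (by omega) (by omega)
      rw [hf.last] at h2
      omega)
  have hlen := hall.length_eq
  rw [List.length_range'] at hlen
  refine ⟨hlen, fun j hj1 hjN => ?_⟩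
  have hget := hall.get (i := j - 1) (by omega) (by rw [List.length_range']; omega)
  simp only [List.get_eq_getElem, List.getElem_range'] at hget
  rw [show 1 + 1 * (j - 1) = j by omega] at hget
  unfold est
  rw [List.getD_eq_getElem _ _ (by omega)]
  exact hget

end

/-! ### The noise -/

theorem hasSubgaussianMGF_of_hasLaw {Ω : Type*} [MeasurableSpace Ω] {μ : Measure Ω} {X : Ω → ℝ}
    (h : HasLaw X (gaussianReal 0 1) μ) : HasSubgaussianMGF X 1 μ where
  integrable_exp_mul t := by
    have hi := integrable_exp_mul_gaussianReal (μ := 0) (v := 1) t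
    rw [← h.map_eq] at hi
    exact (integrable_map_measure hi.aestronglyMeasurable h.aemeasurable).1 hi
  mgf_le t := by
    rw [mgf_gaussianReal h.map_eq]
    simp

/-- Tail bound for block sums of independent standard Gaussian variables. -/
theorem measureReal_lt_sq_sum_le {Ω ι : Type*} [MeasurableSpace Ω] {μ : Measure Ω}
    [IsProbabilityMeasure μ] {X : ι → Ω → ℝ} (hlaw : ∀ i, HasLaw (X i) (gaussianReal 0 1) μ)
    (hind : iIndepFun X μ) (A : Finset ι) {x : ℝ} (hx : 0 ≤ x) :
    μ.real {ω | x ^ 2 * A.card < (∑ i ∈ A, X i ω) ^ 2} ≤ 2 * Real.exp (-x ^ 2 / 2) := by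
  rcases A.eq_empty_or_nonempty with rfl | hA
  · simp
    positivity
  have hc : (0 : ℝ) < A.card := by exact_mod_cast hA.card_pos
  have hε : 0 ≤ x * √A.card := by positivity
  have hsub := fun i => hasSubgaussianMGF_of_hasLaw (hlaw i)
  have h1 := HasSubgaussianMGF.measure_sum_ge_le_of_iIndepFun hind (s := A) (c := fun _ => 1)
    (fun i _ => hsub i) hε
  have h2 := HasSubgaussianMGF.measure_sum_ge_le_of_iIndepFun
    (hind.comp (fun _ => Neg.neg) fun _ => measurable_neg) (s := A) (c := fun _ => 1)
    (fun i _ => (hsub i).neg) hε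
  have e : -(x * √A.card) ^ 2 / (2 * ((∑ _i ∈ A, (1 : NNReal) : NNReal) : ℝ)) = -x ^ 2 / 2 := by
    rw [mul_pow, Real.sq_sqrt hc.le]
    simp
    field_simp
  rw [e] at h1 h2
  have hsubset : {ω | x ^ 2 * A.card < (∑ i ∈ A, X i ω) ^ 2} ⊆
      {ω | x * √A.card ≤ ∑ i ∈ A, X i ω} ∪
        -- The lower tail is the upper tail of the negated variables, which are again independent
        -- and sub-Gaussian.
        {ω | x * √A.card ≤ ∑ i ∈ A, (Neg.neg ∘ X i) ω} := by
    intro ω hω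
    have hω' : (x * √A.card) ^ 2 < (∑ i ∈ A, X i ω) ^ 2 := by
      rw [mul_pow, Real.sq_sqrt hc.le]
      exact hω
    have h3 := sq_lt_sq.1 hω'
    rw [abs_of_nonneg hε] at h3
    rcases lt_abs.1 h3 with h4 | h4
    · exact Or.inl h4.le
    · right
      simpa using h4.le
  have h3 := (measureReal_mono hsubset).trans (measureReal_union_le (μ := μ) _ _)
  linarith

theorem measureReal_not_noiseBound_le {Ω : Type*} [MeasurableSpace Ω] {μ : Measure Ω}
    [IsProbabilityMeasure μ] {T : ℕ} (hT : 1 ≤ T) {ε : ℕ → Ω → ℝ}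
    (hlaw : ∀ t ∈ Finset.Icc 1 T, HasLaw (ε t) (gaussianReal 0 1) μ)
    (hind : iIndepFun (fun t : Finset.Icc 1 T => ε t) μ) :
    μ.real {ω | ¬ NoiseBound T (fun t => ε t ω) √(6 * Real.log T)} ≤ 2 / T := by
  classical
  have hT0 : (0 : ℝ) < T := by exact_mod_cast hT
  have hlog : 0 ≤ Real.log T := Real.log_nonneg (by exact_mod_cast hT)
  set x := √(6 * Real.log T) with hx
  -- The factor 6 in x² makes each tail T⁻³, leaving 2/T after the sum over T² pairs of end-points.
  have hexp : Real.exp (-x ^ 2 / 2) = 1 / (T : ℝ) ^ 3 := by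
    rw [hx, Real.sq_sqrt (by positivity), show -(6 * Real.log T) / 2 = -(3 * Real.log T) by ring,
      Real.exp_neg, show 3 * Real.log T = ((3 : ℕ) : ℝ) * Real.log T by norm_num,
      ← Real.log_pow, Real.exp_log (by positivity), one_div]
  set I := Finset.Icc 1 T ×ˢ Finset.Icc 1 T with hI
  have hsubset : {ω | ¬ NoiseBound T (fun t => ε t ω) x} ⊆ ⋃ a ∈ I,
      {ω | x ^ 2 * ((Finset.Icc a.1 a.2).card : ℝ) < (∑ t ∈ Finset.Icc a.1 a.2, ε t ω) ^ 2} := by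
    intro ω hω
    simp only [Set.mem_ofPred_eq, NoiseBound, not_forall, not_le] at hω
    obtain ⟨s, e, h1, h2, h3, h4⟩ := hω
    have hse : s ≤ e := by
      by_contra hlt
      have : s = e + 1 := by omega
      subst this
      simp at h4
    refine Set.mem_iUnion₂.2 ⟨(s, e), ?_, ?_⟩
    · simp only [hI, Finset.mem_product, Finset.mem_Icc]
      omega
    · simp only [Set.mem_ofPred_eq, Nat.card_Icc]
      rw [Nat.cast_sub h3]
      push_cast
      exact h4
  have hone : ∀ a ∈ I, μ.real {ω | x ^ 2 * ((Finset.Icc a.1 a.2).card : ℝ) <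
      (∑ t ∈ Finset.Icc a.1 a.2, ε t ω) ^ 2} ≤ 2 * (1 / (T : ℝ) ^ 3) := by
    intro a ha
    simp only [hI, Finset.mem_product, Finset.mem_Icc] at ha
    have h := measureReal_lt_sq_sum_le (X := fun t : Finset.Icc 1 T => ε t)
      (fun t => hlaw t t.2) hind ((Finset.Icc a.1 a.2).subtype (· ∈ Finset.Icc 1 T))
      (Real.sqrt_nonneg (6 * Real.log T))
    rw [← hx, hexp] at h
    have hsub : ∀ t ∈ Finset.Icc a.1 a.2, t ∈ Finset.Icc 1 T := by
      intro t ht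
      rw [Finset.mem_Icc] at *
      omega
    have hcard : ((Finset.Icc a.1 a.2).subtype (· ∈ Finset.Icc 1 T)).card
        = (Finset.Icc a.1 a.2).card := by
      rw [Finset.card_subtype, Finset.filter_true_of_mem hsub]
    have hsum : ∀ ω, ∑ t ∈ (Finset.Icc a.1 a.2).subtype (· ∈ Finset.Icc 1 T), ε t ω
        = ∑ t ∈ Finset.Icc a.1 a.2, ε t ω := fun ω =>
      Finset.sum_subtype_of_mem (fun t => ε t ω) hsub
    simpa only [hcard, hsum] using h
  have hIcard : (I.card : ℝ) = (T : ℝ) ^ 2 := by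
    simp [hI, sq]
  calc μ.real {ω | ¬ NoiseBound T (fun t => ε t ω) x}
      ≤ μ.real (⋃ a ∈ I, {ω | x ^ 2 * ((Finset.Icc a.1 a.2).card : ℝ) <
        (∑ t ∈ Finset.Icc a.1 a.2, ε t ω) ^ 2}) :=
        measureReal_mono hsubset (measure_ne_top _ _)
    _ ≤ ∑ a ∈ I, μ.real {ω | x ^ 2 * ((Finset.Icc a.1 a.2).card : ℝ) <
        (∑ t ∈ Finset.Icc a.1 a.2, ε t ω) ^ 2} := measureReal_biUnion_finset_le _ _
    _ ≤ ∑ _a ∈ I, 2 * (1 / (T : ℝ) ^ 3) := Finset.sum_le_sum hone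
    _ = 2 / T := by
      rw [Finset.sum_const, nsmul_eq_mul, hIcard]
      field_simp

/-! ### From the assumptions of the theorem to the deterministic analysis -/

/-- The scale y = δ/(2n) is chosen so that the margin 3δ/(4n) becomes 3y/2. -/
theorem Admissible.nearChange {n : ℝ} {T N : ℕ} {r : ℕ → ℕ} {d : ℕ} (hN : 1 ≤ N)
    (h : Admissible n T N r d) : NearChange N r (minGap N r / (2 * n)) d := by
  have e : 3 / 2 * (minGap N r / (2 * n)) = 3 * minGap N r / (4 * n) := by
    ring
  unfold NearChange
  rw [e]
  rcases h with ⟨-, h⟩ | ⟨h, -⟩ | ⟨j, h1, h2, h3, h4⟩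
  · exact ⟨1, le_rfl, hN, Or.inl rfl, Or.inr h⟩
  · exact ⟨N, hN, le_rfl, Or.inr h, Or.inl rfl⟩
  · exact ⟨j, by omega, by omega, Or.inr h3, Or.inr h4⟩

theorem regime_of_assumptions {n : ℝ} (hn : 3 / 2 ≤ n) {T N : ℕ} {r : ℕ → ℕ} {f ε : ℕ → ℝ}
    {lam : ℕ} {ζ : ℝ} (hT : 2 ≤ T) (hf : IsPiecewiseConstant T N r f) (hlam : 1 ≤ lam)
    (hexp : (lam : ℝ) ≤ minGap N r / (2 * n))
    (hsnr : 1 ≤ N → 38 * √(8 * n) * √(Real.log T) ≤ √(minGap N r) * minJump N r f)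
    (hζ : 18 * √(Real.log T) ≤ ζ)
    (hζ' : 1 ≤ N → ζ < 1 / (2 * √(8 * n)) * √(minGap N r) * minJump N r f)
    (hε : NoiseBound T ε √(6 * Real.log T)) :
    Regime T N r f ε lam √(6 * Real.log T) ζ (minGap N r / (2 * n)) := by
  have hlog : 0 ≤ Real.log T := Real.log_nonneg (by exact_mod_cast (by omega : 1 ≤ T))
  have hsqrt : √(6 * Real.log T) = √6 * √(Real.log T) := Real.sqrt_mul (by norm_num) _
  have h6 : √(6 : ℝ) ≤ 5 / 2 := Real.sqrt_le_iff.2 ⟨by norm_num, by norm_num⟩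
  have hl0 := Real.sqrt_nonneg (Real.log T)
  have hy : (1 : ℝ) ≤ minGap N r / (2 * n) := le_trans (by exact_mod_cast hlam) hexp
  have hδ : 2 * n ≤ minGap N r := by
    rwa [le_div_iff₀ (by linarith), one_mul] at hy
  have hx : √(6 * Real.log T) ≤ 5 / 2 * √(Real.log T) := by
    rw [hsqrt]; exact mul_le_mul_of_nonneg_right h6 hl0
  refine ⟨hf, hε, Real.sqrt_nonneg _, ?_, hlam, hexp, fun j hj => ?_, fun j hj1 hjN => ?_⟩
  · linarith
  -- This is the place where n ≥ 3/2 matters: 3y = 3δ/(2n) ≤ δ.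
  · refine le_trans ?_ (minGap_le_gap N r hj)
    rw [mul_div_assoc', div_le_iff₀ (by linarith)]
    nlinarith
  · have hN : 1 ≤ N := by omega
    have hs := hsnr hN
    have hz := hζ' hN
    -- Detection with y/2 observations on each side needs (ζ + 2x)² below (y/4)·jump² =
    -- δ·jump²/(8n), hence κ² = 8n. The threshold uses less than half of G/κ, and 2x ≤ 5√(log T)
    -- fits into the other half.
    set κ := √(8 * n) with hκ
    have hκ0 : 0 < κ := Real.sqrt_pos.2 (by linarith)
    have hκ2 : κ ^ 2 = 8 * n := Real.sq_sqrt (by linarith)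
    have hjump := minJump_le_jump N r f hj1 hjN
    have hδ0 : 0 ≤ minGap N r := by linarith
    set G := √(minGap N r) * minJump N r f with hG
    have hGle : G ≤ √(minGap N r) * jump r f j :=
      mul_le_mul_of_nonneg_left hjump (Real.sqrt_nonneg _)
    have hz' : ζ < G / κ / 2 := by
      refine hz.trans_eq ?_
      rw [hG]; field_simp
    have hs' : 38 * √(Real.log T) ≤ G / κ := by
      rw [le_div_iff₀ hκ0]; linarith
    have hsum : ζ + 2 * √(6 * Real.log T) < G / κ := by linarith
    have hζ0 : 0 ≤ ζ := by linarith
    calc (ζ + 2 * √(6 * Real.log T)) ^ 2 < (G / κ) ^ 2 :=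
          pow_lt_pow_left₀ hsum (by positivity) two_ne_zero
      _ ≤ (√(minGap N r) * jump r f j / κ) ^ 2 := by
          apply pow_le_pow_left₀
          · linarith
          · exact div_le_div_of_nonneg_right hGle hκ0.le
      _ = minGap N r / (2 * n) / 2 / 2 * jump r f j ^ 2 := by
          rw [div_pow, mul_pow, Real.sq_sqrt hδ0, hκ2]
          field_simp
          ring

end DAIS

theorem theorem1 (n : ℝ) (hn : 3 / 2 ≤ n) :
    ∃ C C₁ C₂ C₃ C₄ : ℝ, 0 < C ∧ 0 < C₁ ∧ 0 < C₂ ∧ 0 < C₃ ∧ 0 < C₄ ∧ C₁ < C₂ * C ∧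
      ∃ T₀ : ℕ, ∀ (T N : ℕ) (r : ℕ → ℕ) (f : ℕ → ℝ) (lam : ℕ) (ζ : ℝ),
        T₀ ≤ T →
        DAIS.IsPiecewiseConstant T N r f →
        1 ≤ lam →
        (lam : ℝ) ≤ DAIS.minGap N r / (2 * n) →
        (1 ≤ N → C * √(Real.log T) ≤ √(DAIS.minGap N r) * DAIS.minJump N r f) →
        C₁ * √(Real.log T) ≤ ζ →
        (1 ≤ N → ζ < C₂ * √(DAIS.minGap N r) * DAIS.minJump N r f) →
        ∀ (Ω : Type*) [MeasurableSpace Ω] (μ : Measure Ω) [IsProbabilityMeasure μ]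
          (ε : ℕ → Ω → ℝ),
          (∀ t ∈ Finset.Icc 1 T, HasLaw (ε t) (gaussianReal 0 1) μ) →
          iIndepFun (fun t : Finset.Icc 1 T => ε t) μ →
          (1 - C₄ / T ≤ μ.real {ω |
              DAIS.LargestDiffAdmissible n T N r (fun t => f t + ε t ω) lam ζ →
              DAIS.Accurate T N r f (fun t => f t + ε t ω) lam ζ (C₃ * Real.log T)}) ∧
          ((∀ᵐ ω ∂μ, DAIS.LargestDiffAdmissible n T N r (fun t => f t + ε t ω) lam ζ) →
            1 - C₄ / T ≤ μ.real {ω |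
              DAIS.Accurate T N r f (fun t => f t + ε t ω) lam ζ (C₃ * Real.log T)}) := by
  have hκ : 0 < √(8 * n) := Real.sqrt_pos.2 (by linarith)
  -- Since √6 ≤ 5/2, 18 ensures ζ ≥ 7x; 1/(2κ) with κ = √(8n) keeps half of the signal for the
  -- noise; 38κ makes the product 19 > 18; and 144 = 24 · 6.
  refine ⟨38 * √(8 * n), 18, 1 / (2 * √(8 * n)), 144, 2, by positivity, by norm_num, by positivity,
    by norm_num, by norm_num, ?_, 2, ?_⟩
  · rw [show 1 / (2 * √(8 * n)) * (38 * √(8 * n)) = 19 by field_simp; norm_num]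
    norm_num
  intro T N r f lam ζ hT hf hlam hexp hsnr hζ hζ' Ω _ μ _ ε hlaw hind
  have hlog : 0 ≤ Real.log T := Real.log_nonneg (by exact_mod_cast (by omega : 1 ≤ T))
  have hbad := DAIS.measureReal_not_noiseBound_le (by omega) hlaw hind
  have hgood : ∀ ω, DAIS.NoiseBound T (fun t => ε t ω) √(6 * Real.log T) →
      DAIS.LargestDiffAdmissible n T N r (fun t => f t + ε t ω) lam ζ →
      DAIS.Accurate T N r f (fun t => f t + ε t ω) lam ζ (144 * Real.log T) := by
    intro ω hω hA
    have hR := DAIS.regime_of_assumptions hn hT hf hlam hexp hsnr hζ hζ' hω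
    have := hR.accurate fun s e hc hse hex =>
      (hA s e hc hse hex).nearChange (by obtain ⟨j, h1, h2, -⟩ := hex; omega)
    rwa [Real.sq_sqrt (by positivity), ← mul_assoc, show (24 : ℝ) * 6 = 144 by norm_num] at this
  have hmain : 1 - 2 / T ≤ μ.real {ω |
      DAIS.LargestDiffAdmissible n T N r (fun t => f t + ε t ω) lam ζ →
      DAIS.Accurate T N r f (fun t => f t + ε t ω) lam ζ (144 * Real.log T)} := by
    -- Covering the whole space and using subadditivity avoids any question of measurability of the
    -- events.
    have hcover : (Set.univ : Set Ω) ⊆ {ω |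
        DAIS.LargestDiffAdmissible n T N r (fun t => f t + ε t ω) lam ζ →
        DAIS.Accurate T N r f (fun t => f t + ε t ω) lam ζ (144 * Real.log T)} ∪
        {ω | ¬ DAIS.NoiseBound T (fun t => ε t ω) √(6 * Real.log T)} := by
      intro ω _
      by_cases hω : DAIS.NoiseBound T (fun t => ε t ω) √(6 * Real.log T)
      · exact Or.inl (hgood ω hω)
      · exact Or.inr hω
    have h1 := (measureReal_mono hcover).trans (measureReal_union_le (μ := μ) _ _)
    rw [probReal_univ] at h1
    linarith
  refine ⟨hmain, fun hae => hmain.trans ?_⟩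
  refine ENNReal.toReal_mono (measure_ne_top _ _) (measure_mono_ae ?_)
  filter_upwards [hae] with ω hω h using h hω
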